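/- \textbf{Theorem (Annealed CLT for $\mathrm{CM}_N(\mathbf 2)$).} For a finite multigraph $G$ with vertex set $[N]=\{1,\dots,N\}$ and a spin configuration $\sigma\in\Omega_N=\{-1,1\}^N$, let $S_N(\sigma)=\sum_{i\in[N]}\sigma_i$ and $$w_{G}(\sigma)=\exp\Big[\beta\sum_{\{i,j\}\in E(G)}\sigma_i\sigma_j+B\,S_N(\sigma)\Big],\qquad Z_{G}(\beta,B)=\sum_{\sigma\in\Omega_N}w_{G}(\sigma),$$ where the edges in $E(G)$, including self-loops, are counted with multiplicity. The Boltzmann--Gibbs measure on $G$ is $\mu_G(\sigma)=w_G(\sigma)/Z_G(\beta,B)$, and the susceptibility of the Ising model on $G$ is $$\chi_G(\beta,B)=\frac{\partial}{\partial B}\,\mu_G\Big(\frac{S_N}{N}\Big).$$ Let $(G_N)_{N\ge1}$ be a sequence of random multigraphs, defined on a common probability space (with an arbitrary joint law), such that $G_N$ is a 2-regular configuration model $\mathrm{CM}_N(\mathbf 2)$: two half-edges are attached to each vertex of $[N]$, the $2N$ half-edges are paired uniformly at random, and each pair forms an edge. Let $Q_N$ denote expectation with respect to the law of $G_N$, and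 let $\widetilde P_N$ be the annealed measure on $\Omega_N$, $$\widetilde P_N(\sigma)=\frac{Q_N\big(w_{G_N}(\sigma)\big)}{Q_N\big(Z_{G_N}(\beta,B)\big)}.$$ Then for all $\beta\ge0$ and $B\in\mathbb R$ there is a number $\chi=\chi(\beta,B)\ge 0$ such that the following hold. (i) The total spin satisfies the central limit theorem $$\frac{S_N-\widetilde P_N(S_N)}{\sqrt N}\ \xrightarrow{\ \mathcal D\ }\ \mathcal N(0,\chi)\qquad\text{w.r.t. }\widetilde P_N,\ \text{as }N\to\infty,$$ where $\mathcal N(0,\chi)$ is the centered normal law with variance $\chi$. (ii) $\chi$ is the thermodynamic limit of the (random) quenched susceptibility: almost surely, $\chi_{G_N}(\beta,B)\to\chi$ as $N\to\infty$. (iii) $\chi$ is the susceptibility of the one-dimensional Ising model: $\chi_{C_N}(\beta,B)\to\chi$ as $N\to\infty$, where $C_N$ is the cycle with $N$ vertices (periodic boundary conditions). Explicitly, $$\chi(\beta,B)=\chi^{d=1}(\beta,B)=\frac{\cosh(B)\,e^{-4\beta}}{\big(\sinh^2(B)+e^{-4\beta}\big)^{3/2}}.$$ -/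

import Mathlib

open MeasureTheory ProbabilityTheory Filter
open scoped Topology NNReal ENNReal

noncomputable section

/-! ### Multigraphs and the configuration model -/

/-- A finite undirected multigraph on the vertex set `V`: a multiset of unordered pairs of
vertices, so that self-loops and multiple edges are allowed. -/
structure Multigraph (V : Type) where
  edges : Multiset (Sym2 V)

instance (V : Type) : MeasurableSpace (Multigraph V) := ⊤

/-- The half-edges attached to the vertices `0, …, N - 1`, with `d i` of them at vertex `i`. -/
abbrev HalfEdge {N : ℕ} (d : Fin N → ℕ) : Type := Σ i : Fin N, Fin (d i)

/-- A pairing of the half-edges (a perfect matching): a fixed-point free involution. -/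
def Pairing {N : ℕ} (d : Fin N → ℕ) : Type :=
  {π : Equiv.Perm (HalfEdge d) // ∀ h, π h ≠ h ∧ π (π h) = h}

instance {N : ℕ} (d : Fin N → ℕ) : Finite (Pairing d) :=
  inferInstanceAs (Finite {π : Equiv.Perm (HalfEdge d) // ∀ h, π h ≠ h ∧ π (π h) = h})

instance {N : ℕ} (d : Fin N → ℕ) : MeasurableSpace (Pairing d) := ⊤

instance {N : ℕ} (d : Fin N → ℕ) : MeasurableSingletonClass (Pairing d) := ⟨fun _ => trivial⟩

instance {N : ℕ} : Nonempty (Pairing (fun _ : Fin N => 2)) :=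
  ⟨⟨Equiv.sigmaCongrRight fun _ => Equiv.swap 0 1, by
    rintro ⟨i, k⟩
    fin_cases k <;> simp⟩⟩

/-- The multigraph produced by a pairing. The pairs `{h, π h}` of half-edges are collected in a
finset (each pair once), and every such pair becomes one edge between the vertices that carry
the two half-edges. -/
def Pairing.toMultigraph {N : ℕ} {d : Fin N → ℕ} (π : Pairing d) : Multigraph (Fin N) :=
  ⟨((Finset.univ.image fun h : HalfEdge d => s(h, π.1 h)).val).map (Sym2.map Sigma.fst)⟩

/-- The law of the configuration model with degree sequence `d`: the half-edges are paired
uniformly at random. -/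
def configurationModel {N : ℕ} (d : Fin N → ℕ) : Measure (Multigraph (Fin N)) :=
  (uniformOn (Set.univ : Set (Pairing d))).map Pairing.toMultigraph

/-- The law of the 2-regular configuration model on `N` vertices. -/
def twoRegularCM (N : ℕ) : Measure (Multigraph (Fin N)) :=
  configurationModel (fun _ : Fin N => 2)

instance (N : ℕ) : IsProbabilityMeasure (twoRegularCM N) :=
  have : IsProbabilityMeasure (uniformOn (Set.univ : Set (Pairing fun _ : Fin N => 2))) :=
    isProbabilityMeasure_uniformOn Set.finite_univ Set.univ_nonempty
  Measure.isProbabilityMeasure_map (measurable_from_top).aemeasurable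

/-! ### The Ising model on a multigraph -/

/-- Spin configurations on `N` vertices; `ℤˣ = {1, -1}`. -/
abbrev SpinConfig (N : ℕ) : Type := Fin N → ℤˣ

/-- The value `±1` of the spin at vertex `i` as a real number. -/
def spin {N : ℕ} (σ : SpinConfig N) (i : Fin N) : ℝ := ((σ i : ℤ) : ℝ)

/-- The total spin. -/
def totalSpin {N : ℕ} (σ : SpinConfig N) : ℝ := ∑ i, spin σ i

/-- The sum, over the edges `{i, j}` with multiplicity, of the products of the end spins. -/
def edgeSum {N : ℕ} (G : Multigraph (Fin N)) (σ : SpinConfig N) : ℝ :=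
  (G.edges.map
    (Sym2.lift ⟨fun i j => spin σ i * spin σ j, fun _ _ => mul_comm _ _⟩)).sum

/-- The Boltzmann weight at inverse temperature `β` and external field `B`. -/
def boltzmannWeight {N : ℕ} (G : Multigraph (Fin N)) (β B : ℝ) (σ : SpinConfig N) : ℝ :=
  Real.exp (β * edgeSum G σ + B * totalSpin σ)

/-- The partition function. -/
def partitionFunction {N : ℕ} (G : Multigraph (Fin N)) (β B : ℝ) : ℝ :=
  ∑ σ, boltzmannWeight G β B σ

/-- The magnetization per vertex: the mean of the total spin divided by `N` under the
Boltzmann-Gibbs measure of the (fixed) multigraph `G`. -/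
def magnetization {N : ℕ} (G : Multigraph (Fin N)) (β B : ℝ) : ℝ :=
  (∑ σ, boltzmannWeight G β B σ / partitionFunction G β B * totalSpin σ) / N

/-- The finite-volume (quenched) susceptibility of the multigraph `G`: the derivative of the
magnetization with respect to the external field. -/
def susceptibility {N : ℕ} (G : Multigraph (Fin N)) (β B : ℝ) : ℝ :=
  deriv (fun b => magnetization G β b) B

/-- The cycle with `N` vertices, that is, the one-dimensional lattice with periodic boundary
conditions (a self-loop for `N = 1`, a double edge for `N = 2`). -/
def cycle (N : ℕ) : Multigraph (Fin N) :=
  ⟨Finset.univ.val.map fun i : Fin N => s(i, finRotate N i)⟩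

/-! ### The annealed measure -/

/-- The annealed probability of a spin configuration, for the random graph law `Q`: numerator
and denominator of the Boltzmann-Gibbs distribution are averaged separately. -/
def annealedProb {N : ℕ} (Q : Measure (Multigraph (Fin N))) (β B : ℝ) (σ : SpinConfig N) : ℝ :=
  (∫ G, boltzmannWeight G β B σ ∂Q) / ∫ G, partitionFunction G β B ∂Q

/-- The annealed measure on spin configurations. -/
def annealedMeasure {N : ℕ} (Q : Measure (Multigraph (Fin N))) (β B : ℝ) :
    Measure (SpinConfig N) :=
  ∑ σ, ENNReal.ofReal (annealedProb Q β B σ) • Measure.dirac σ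

lemma boltzmannWeight_pos {N : ℕ} (G : Multigraph (Fin N)) (β B : ℝ) (σ : SpinConfig N) :
    0 < boltzmannWeight G β B σ := Real.exp_pos _

lemma integrable_twoRegularCM {N : ℕ} (f : Multigraph (Fin N) → ℝ) :
    Integrable f (twoRegularCM N) := by
  have : IsProbabilityMeasure (uniformOn (Set.univ : Set (Pairing fun _ : Fin N => 2))) :=
    isProbabilityMeasure_uniformOn Set.finite_univ Set.univ_nonempty
  refine (integrable_map_measure measurable_from_top.aestronglyMeasurable
    measurable_from_top.aemeasurable).2 Integrable.of_finite

instance (N : ℕ) (β B : ℝ) : IsProbabilityMeasure (annealedMeasure (twoRegularCM N) β B) := by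
  have hZ : ∫ G, partitionFunction G β B ∂(twoRegularCM N)
      = ∑ σ, ∫ G, boltzmannWeight G β B σ ∂(twoRegularCM N) :=
    integral_finsetSum _ fun σ _ => integrable_twoRegularCM _
  have hpos : 0 < ∫ G, partitionFunction G β B ∂(twoRegularCM N) := by
    have hp : ∀ G : Multigraph (Fin N), 0 < partitionFunction G β B := fun G =>
      Finset.sum_pos (fun σ _ => boltzmannWeight_pos G β B σ) Finset.univ_nonempty
    rw [integral_pos_iff_support_of_nonneg (fun G => (hp G).le) (integrable_twoRegularCM _)]
    have : Function.support (fun G : Multigraph (Fin N) => partitionFunction G β B)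
        = Set.univ := Set.eq_univ_of_forall fun G => (hp G).ne'
    rw [this]
    simp
  have hnn : ∀ σ : SpinConfig N, 0 ≤ annealedProb (twoRegularCM N) β B σ := fun σ =>
    div_nonneg (integral_nonneg fun G => (boltzmannWeight_pos G β B σ).le) hpos.le
  refine ⟨?_⟩
  simp only [annealedMeasure, Measure.coe_finsetSum, Finset.sum_apply, Measure.smul_apply,
    measure_univ, smul_eq_mul, mul_one]
  rw [← ENNReal.ofReal_sum_of_nonneg fun σ _ => hnn σ]
  simp only [annealedProb]
  rw [← Finset.sum_div, ← hZ, div_self hpos.ne', ENNReal.ofReal_one]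

end

/-! A 2-regular multigraph is a disjoint union of cycles, and a cycle of length `L` has partition
function `λ₊ ^ L + λ₋ ^ L`, with `λ₊, λ₋` the eigenvalues of the 2 × 2 transfer matrix. The cycles
are never classified. Diagonalizing the vertex and edge tensors together (`sum_spin_eq_sum_mono`)
turns the partition function into the sum, over 2-colourings of the vertices constant along edges,
of the product of the eigenvalues chosen by the colours. This formula is used in two ways.

Quenched side: the sum factorizes over components. The total magnetization is `N * m`, with `m =
(log λ₊)'`, plus one deviation per component; its field derivative is bounded uniformly in the
length, since `r = λ₋ / λ₊` satisfies `0 ≤ r < 1`. So the susceptibility is within `C * #components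
/ N` of `χ = m'`. The cycle has at most one component. For the random graph, putting both
eigenvalues equal to 1 gives `2 ^ #components`, whose mean is at most `N + 1`; Markov's inequality
and Borel-Cantelli then give almost sure convergence for any joint law.

Annealed side: averaging over pairings first, for a fixed colouring, counts the pairings that
preserve a colour class of size `k`. With `p` the return probabilities of the simple random walk,
the mean partition function is `λ₊ ^ N * A_N(r)`, where `A_N(r) = ∑ r ^ k * p_k * p_(N-k) / p_N`.
The characteristic function of the total spin is a ratio of such means at the fields `B + i s / √N`
and `B`. The powers of `λ₊` give `exp (-χ s² / 2)` after centring by `N * m`; the two values of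
`A_N` have the same nonzero limit; and the annealed mean is `N * m + O(1)` because `A_N' / A_N`
stays bounded. -/

noncomputable section

/-! ### Spin sums on 2-regular multigraphs -/

open Finset in
theorem sum_prod_pair_eq_prod_sum {E S R : Type*} [Fintype E] [DecidableEq E] [Fintype S]
    [DecidableEq S] [CommRing R] (F : E → S → S → R) :
    ∑ x : E × Bool → S, ∏ e, F e (x (e, false)) (x (e, true)) = ∏ e, ∑ s, ∑ s', F e s s' := by
  have h : ∀ e, ∑ s, ∑ s', F e s s' = ∑ p : S × S, F e p.1 p.2 := fun e => by
    rw [Fintype.sum_prod_type]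
  simp_rw [h]
  rw [Finset.prod_univ_sum, Fintype.piFinset_univ]
  refine Fintype.sum_equiv
    ((Equiv.curry E Bool S).trans (Equiv.piCongrRight fun _ => Equiv.boolArrowEquivProd S)) _ _ ?_
  intro x
  rfl

/-! ### Monochromatic colourings and connected components. -/

section HalfEdges

variable {V E : Type} [Fintype V]

/-- The multigraph on `V` with edge set `E` given by a bijection between the ends of the edges and
two half-edges at every vertex. -/
def halfEdgeGraph {V E : Type} [Fintype E] (φ : E × Bool ≃ V × Bool) : Multigraph V :=
  ⟨Finset.univ.val.map fun e : E => s((φ (e, false)).1, (φ (e, true)).1)⟩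

/-- A colouring of the vertices is monochromatic if the ends of every edge have equal colours. -/
def IsMono {T : Type*} (φ : E × Bool ≃ V × Bool) (y : V → T) : Prop :=
  ∀ e, y (φ (e, false)).1 = y (φ (e, true)).1

/-- Double counting: a colour class has as many edges as vertices, because twice either number is
the number of half-edges of that colour. -/
theorem IsMono.prod_edges [Fintype E] {T R : Type*} [Fintype T] [CommRing R]
    {φ : E × Bool ≃ V × Bool} {y : V → T} (hy : IsMono φ y) (μ : T → R) :
    ∏ e, μ (y (φ (e, false)).1) = ∏ v, μ (y v) := by
  classical
  rw [← Fintype.prod_fiberwise (fun e => y (φ (e, false)).1),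
    ← Fintype.prod_fiberwise y (fun v => μ (y v))]
  refine Finset.prod_congr rfl fun t _ => ?_
  have h1 : ∀ i : {e : E // y (φ (e, false)).1 = t}, μ (y (φ (i.1, false)).1) = μ t :=
    fun i => congrArg μ i.2
  have h2 : ∀ i : {v : V // y v = t}, μ (y i) = μ t := fun i => congrArg μ i.2
  simp_rw [h1, h2, Finset.prod_const]
  congr 1
  simp only [Finset.card_univ]
  have h : Fintype.card ({e : E // y (φ (e, false)).1 = t} × Bool)
      = Fintype.card ({v : V // y v = t} × Bool) := by
    refine Fintype.card_congr ?_
    refine Equiv.trans (β := {p : E × Bool // y (φ p).1 = t}) ?_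
      (Equiv.trans (φ.subtypeEquiv (q := fun h => y h.1 = t) fun _ => Iff.rfl) ?_)
    · have hp : ∀ p : E × Bool, y (φ p).1 = y (φ (p.1, false)).1 := by
        rintro ⟨e, b⟩
        cases b
        · rfl
        · exact (hy e).symm
      exact ⟨fun p => ⟨(p.1.1, p.2), by rw [hp]; exact p.1.2⟩,
        fun p => (⟨p.1.1, by rw [← hp]; exact p.2⟩, p.1.2), fun _ => rfl, fun _ => rfl⟩
    · exact ⟨fun p => (⟨p.1.1, p.2⟩, p.1.2), fun p => ⟨(p.1.1, p.2), p.1.2⟩,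
        fun _ => rfl, fun _ => rfl⟩
  simp only [Fintype.card_prod, Fintype.card_bool] at h
  omega

open scoped Classical in
/-- Simultaneous diagonalization of the vertex tensor and of the edge tensor turns a spin sum on a
2-regular multigraph into a sum over monochromatic colourings. -/
theorem sum_spin_eq_sum_mono [DecidableEq V] [Fintype E] {S T R : Type*} [Fintype S] [Fintype T]
    [CommRing R] (φ : E × Bool ≃ V × Bool)
    (g : S → T → R) (K : S → S → R) (d : S → R) (c μ : T → R)
    (hD : ∀ x x', ∑ t, c t * (g x t * g x' t) = if x = x' then d x else 0)
    (hK : ∀ t t', ∑ x, ∑ x', g x t * g x' t' * K x x' = if t = t' then μ t else 0) :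
    ∑ σ : V → S, (∏ e, K (σ (φ (e, false)).1) (σ (φ (e, true)).1)) * ∏ v, d (σ v)
      = ∑ y : V → T, if IsMono φ y then ∏ v, c (y v) * μ (y v) else 0 := by
  -- Every half-edge receives its own spin; the vertex factor forces the two spins at a vertex to
  -- agree.
  have h1 : ∑ σ : V → S, (∏ e, K (σ (φ (e, false)).1) (σ (φ (e, true)).1)) * ∏ v, d (σ v)
      = ∑ x : V × Bool → S, (∏ e, K (x (φ (e, false))) (x (φ (e, true)))) *
        ∏ v, if x (v, false) = x (v, true) then d (x (v, false)) else 0 := by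
    refine Finset.sum_of_injOn (fun σ h => σ h.1) ?_
      (fun _ _ => Finset.mem_coe.2 (Finset.mem_univ _)) ?_ ?_
    · intro σ _ σ' _ h
      funext v
      exact congrFun h (v, false)
    · intro x _ hx
      have : ∃ v, x (v, false) ≠ x (v, true) := by
        by_contra! hc
        refine hx ⟨fun v => x (v, false), Finset.mem_coe.2 (Finset.mem_univ _), ?_⟩
        funext ⟨v, b⟩
        cases b
        · rfl
        · exact hc v
      obtain ⟨v, hv⟩ := this
      rw [Finset.prod_eq_zero (Finset.mem_univ v) (if_neg hv), mul_zero]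
    · intro σ _
      simp
  rw [h1]
  -- By `hD`, each vertex factor becomes a sum over a colour of that vertex.
  have h2 : ∀ x : V × Bool → S,
      (∏ v, if x (v, false) = x (v, true) then d (x (v, false)) else 0)
        = ∑ y : V → T, (∏ v, c (y v)) * ∏ p : E × Bool, g (x (φ p)) (y (φ p).1) := by
    intro x
    simp_rw [← hD]
    rw [Finset.prod_univ_sum, Fintype.piFinset_univ]
    refine Finset.sum_congr rfl fun y _ => ?_
    rw [Finset.prod_mul_distrib, Equiv.prod_comp φ (fun h => g (x h) (y h.1)),
      Fintype.prod_prod_type]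
    congr 1
    refine Finset.prod_congr rfl fun v _ => ?_
    rw [Fintype.prod_bool, mul_comm]
  simp_rw [h2, Finset.mul_sum]
  rw [Finset.sum_comm]
  refine Finset.sum_congr rfl fun y _ => ?_
  let F : E → S → S → R := fun e s s' =>
    g s (y (φ (e, false)).1) * g s' (y (φ (e, true)).1) * K s s'
  have h3 : ∀ x : V × Bool → S, (∏ e, K (x (φ (e, false))) (x (φ (e, true)))) *
      ((∏ v, c (y v)) * ∏ p : E × Bool, g (x (φ p)) (y (φ p).1))
      = (∏ v, c (y v)) * ∏ e, F e ((x ∘ φ) (e, false)) ((x ∘ φ) (e, true)) := by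
    intro x
    rw [Fintype.prod_prod_type, mul_left_comm, ← Finset.prod_mul_distrib]
    congr 1
    refine Finset.prod_congr rfl fun e _ => ?_
    rw [Fintype.prod_bool]
    simp only [Function.comp, F]
    ring
  rw [Finset.sum_congr rfl fun x _ => h3 x, ← Finset.mul_sum]
  -- For fixed colours, the spins at different edges are now independent, so the spin sum factorizes
  -- over edges and `hK` kills every edge with two colours.
  have h4 := Fintype.sum_equiv (φ.symm.arrowCongr (Equiv.refl S))
    (fun x : V × Bool → S => ∏ e, F e ((x ∘ φ) (e, false)) ((x ∘ φ) (e, true)))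
    (fun x : E × Bool → S => ∏ e, F e (x (e, false)) (x (e, true))) (fun x => rfl)
  rw [h4, sum_prod_pair_eq_prod_sum F]
  simp only [F]
  simp_rw [hK]
  split_ifs with hy
  · rw [Finset.prod_mul_distrib, ← hy.prod_edges μ]
    congr 1
    exact Finset.prod_congr rfl fun e _ => if_pos (hy e)
  · obtain ⟨e, he⟩ := not_forall.1 hy
    rw [Finset.prod_eq_zero (Finset.mem_univ e) (if_neg he), mul_zero]

/-- The connected components of the multigraph `halfEdgeGraph φ`. -/
abbrev Component (φ : E × Bool ≃ V × Bool) : Type :=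
  Quot fun v w => ∃ e, (φ (e, false)).1 = v ∧ (φ (e, true)).1 = w

instance (φ : E × Bool ≃ V × Bool) : Finite (Component φ) :=
  Quot.finite _

instance (φ : E × Bool ≃ V × Bool) : Fintype (Component φ) :=
  Fintype.ofFinite _

open scoped Classical in
/-- The number of vertices of a connected component. -/
def Component.size {φ : E × Bool ≃ V × Bool} (k : Component φ) : ℕ :=
  Fintype.card {v : V // Quot.mk _ v = k}

theorem Component.sum_size (φ : E × Bool ≃ V × Bool) :
    ∑ k : Component φ, k.size = Fintype.card V := by
  classical
  simp only [Component.size]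
  rw [← Fintype.card_sigma]
  exact Fintype.card_congr (Equiv.sigmaFiberEquiv _)

/-- Monochromatic colourings are the colourings of the connected components. -/
def monoEquiv (T : Type*) (φ : E × Bool ≃ V × Bool) :
    {y : V → T // IsMono φ y} ≃ (Component φ → T) where
  toFun y := Quot.lift y.1 (by rintro _ _ ⟨e, rfl, rfl⟩; exact y.2 e)
  invFun τ := ⟨fun v => τ (Quot.mk _ v), fun e => congrArg τ (Quot.sound ⟨e, rfl, rfl⟩)⟩
  left_inv _ := rfl
  right_inv τ := by
    funext k
    obtain ⟨v, rfl⟩ := Quot.exists_rep k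
    rfl

open scoped Classical in
theorem sum_mono_eq_prod_component [DecidableEq V] {T R : Type*} [Fintype T] [CommRing R]
    (φ : E × Bool ≃ V × Bool) (l : T → R) :
    ∑ y : V → T, (if IsMono φ y then ∏ v, l (y v) else 0)
      = ∏ k : Component φ, ∑ t, l t ^ k.size := by
  rw [← Finset.sum_filter, Finset.sum_subtype (p := IsMono φ) _ (by simp), Finset.prod_univ_sum,
    Fintype.piFinset_univ]
  refine Fintype.sum_equiv (monoEquiv T φ) _ _ fun y => ?_
  rw [← Fintype.prod_fiberwise (fun v => (Quot.mk _ v : Component φ))]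
  refine Finset.prod_congr rfl fun k _ => ?_
  have : ∀ i : {v : V // (Quot.mk _ v : Component φ) = k}, l (y.1 i) = l (monoEquiv T φ y k) := by
    rintro ⟨v, rfl⟩
    rfl
  simp_rw [this]
  rw [Finset.prod_const]
  rfl

end HalfEdges

/-! ### The transfer matrix of the Ising model. -/

theorem sum_units_int {R : Type*} [AddCommMonoid R] (f : ℤˣ → R) : ∑ x, f x = f 1 + f (-1) := by
  have : (Finset.univ : Finset ℤˣ) = {1, -1} := rfl
  rw [this, Finset.sum_pair (by decide)]

/-- The eigenvalues of the transfer matrix of the one-dimensional Ising model with edge weights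
`k` and `q` and vertex weights `a` and `b`, written with the square root `s` of the discriminant. -/
def transferEigenvalue {F : Type*} [Field F] (k a b s : F) (t : Bool) : F :=
  k * (a + b) / 2 + bif t then -s else s

-- With `D = diag(a, b)` and `K` the matrix of edge weights, the columns `g · t` are eigenvectors of
-- `D K`. They are orthogonal for `D⁻¹`, which yields both hypotheses of `sum_spin_eq_sum_mono`,
-- with `c t * μ t` the eigenvalue. A general field serves real and complex external fields at once.
open scoped Classical in
theorem sum_ising_eq_sum_mono {V E F : Type} [Fintype V] [DecidableEq V] [Fintype E]
    [Field F] [CharZero F]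
    (φ : E × Bool ≃ V × Bool) {k q a b s : F} (hab : a * b = 1) (hq : q ≠ 0) (hs : s ≠ 0)
    (hsq : s ^ 2 = (k * (a - b) / 2) ^ 2 + q ^ 2) :
    ∑ σ : V → ℤˣ, (∏ e, if σ (φ (e, false)).1 = σ (φ (e, true)).1 then k else q) *
        ∏ v, (if σ v = 1 then a else b)
      = ∑ y : V → Bool, if IsMono φ y then ∏ v, transferEigenvalue k a b s (y v) else 0 := by
  have ha : a ≠ 0 := left_ne_zero_of_mul_eq_one hab
  obtain ⟨p, hp⟩ : ∃ p, p = k * (a - b) / 2 := ⟨_, rfl⟩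
  rw [← hp] at hsq
  have hb : k * b = k * a - 2 * p := by rw [hp]; ring
  have hprod : (s - p) * (s + p) = q ^ 2 := by linear_combination hsq
  have h1 : s - p ≠ 0 := fun h => hq (by simpa [h] using hprod.symm)
  have h2 : s + p ≠ 0 := fun h => hq (by simpa [h] using hprod.symm)
  let S : Bool → F := fun t => bif t then -s else s
  have hS : ∀ t, S t ^ 2 = p ^ 2 + q ^ 2 := by rintro (_ | _) <;> simp [S, hsq]
  have hS0 : ∀ t, S t * (S t - p) ≠ 0 := by
    rintro (_ | _)
    · exact mul_ne_zero hs h1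
    · have : S true * (S true - p) = s * (s + p) := by simp only [S, cond_true]; ring
      rw [this]
      exact mul_ne_zero hs h2
  let g : ℤˣ → Bool → F := fun x t => if x = 1 then a * q else S t - p
  -- The value of the quadratic form `D⁻¹ = diag(b, a)` at the eigenvector `g · t`, simplified by `S
  -- t ^ 2 = p ^ 2 + q ^ 2`.
  let n : Bool → F := fun t => 2 * a * (S t * (S t - p))
  have hn : ∀ t, n t ≠ 0 := fun t => mul_ne_zero (mul_ne_zero two_ne_zero ha) (hS0 t)
  have hlam : ∀ t, transferEigenvalue k a b s t = k * a - p + S t := fun t => by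
    rw [transferEigenvalue, hp]; ring
  have hu : (-1 : ℤˣ) ≠ 1 := by decide
  have hu' : (1 : ℤˣ) ≠ -1 := by decide
  have key := sum_spin_eq_sum_mono φ g (fun x x' => if x = x' then k else q)
    (fun x => if x = 1 then a else b) (fun t => (n t)⁻¹)
    (fun t => n t * transferEigenvalue k a b s t) ?_ ?_
  · rw [key]
    refine Finset.sum_congr rfl fun y _ => ?_
    congr 1
    refine Finset.prod_congr rfl fun v _ => ?_
    rw [inv_mul_cancel_left₀ (hn _)]
  · have hinv : (n true)⁻¹ + (n false)⁻¹ = (a * q ^ 2)⁻¹ := by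
      have e1 : n true = 2 * a * (s * (s + p)) := by simp only [n, S, cond_true]; ring
      have e2 : n false = 2 * a * (s * (s - p)) := by simp only [n, S, cond_false]
      rw [e1, e2, ← hprod]
      field_simp
      ring
    have e1 : (n true)⁻¹ * (S true - p) + (n false)⁻¹ * (S false - p) = 0 := by
      have e : ∀ t, (n t)⁻¹ * (S t - p) = (2 * a * S t)⁻¹ := fun t => by
        have h3 := left_ne_zero_of_mul (hS0 t)
        have h4 := right_ne_zero_of_mul (hS0 t)
        simp only [n]
        field_simp
      rw [e, e]
      simp only [S, cond_true, cond_false]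
      field_simp
      ring
    have e2 : (n true)⁻¹ * (S true - p) ^ 2 + (n false)⁻¹ * (S false - p) ^ 2 = b := by
      have e : ∀ t, (n t)⁻¹ * (S t - p) ^ 2 = (2 * a * S t)⁻¹ * (S t - p) := fun t => by
        have h3 := left_ne_zero_of_mul (hS0 t)
        have h4 := right_ne_zero_of_mul (hS0 t)
        simp only [n]
        field_simp
      rw [e, e, eq_inv_of_mul_eq_one_right hab]
      simp only [S, cond_true, cond_false]
      field_simp
      ring
    intro x x'
    rw [Fintype.sum_bool]
    rcases Int.units_eq_one_or x with rfl | rfl <;> rcases Int.units_eq_one_or x' with rfl | rfl <;>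
      simp only [g, hu, hu', if_true, if_false]
    · rw [← add_mul, hinv]
      field_simp
    · linear_combination a * q * e1
    · linear_combination a * q * e1
    · linear_combination e2
  · intro t t'
    rw [sum_units_int]
    simp_rw [sum_units_int]
    simp only [g, hu, hu', if_true, if_false]
    have hr : a * q * (a * q) * k + a * q * (S t' - p) * q +
        ((S t - p) * (a * q) * q + (S t - p) * (S t' - p) * k)
        = a * (q ^ 2 + (S t - p) * (S t' - p)) * (k * a - p + S t') := by
      have hSk : k = a * (k * a - 2 * p) := by
        rw [← hb]; linear_combination (-k) * hab
      linear_combination (S t - p) * (S t' - p) * hSk - a * (S t - p) * hS t'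
    rw [hr, hlam]
    by_cases h : t = t'
    · subst h
      rw [if_pos rfl]
      simp only [n]
      linear_combination (-a) * (k * a - p + S t) * hS t
    -- Distinct colours carry opposite square roots, which gives the orthogonality.
    · rw [if_neg h]
      have : S t' = - S t := by
        cases t <;> cases t' <;> simp_all [S]
      rw [this]
      linear_combination (-a) * (k * a - p - S t) * hS t

/-! ### The Ising model on 2-regular multigraphs -/

theorem edgeSum_halfEdgeGraph {N : ℕ} {E : Type} [Fintype E] (φ : E × Bool ≃ Fin N × Bool)
    (σ : SpinConfig N) :
    edgeSum (halfEdgeGraph φ) σ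
      = ∑ e, spin σ (φ (e, false)).1 * spin σ (φ (e, true)).1 := by
  simp only [edgeSum, halfEdgeGraph, Multiset.map_map]
  rfl

/-- The Boltzmann weight with a complex external field. -/
def complexWeight {N : ℕ} (G : Multigraph (Fin N)) (β : ℝ) (z : ℂ) (σ : SpinConfig N) : ℂ :=
  Complex.exp (β * edgeSum G σ + z * totalSpin σ)

/-- The partition function with a complex external field. -/
def complexPartition {N : ℕ} (G : Multigraph (Fin N)) (β : ℝ) (z : ℂ) : ℂ :=
  ∑ σ, complexWeight G β z σ

theorem ofReal_boltzmannWeight {N : ℕ} (G : Multigraph (Fin N)) (β b : ℝ) (σ : SpinConfig N) :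
    (boltzmannWeight G β b σ : ℂ) = complexWeight G β b σ := by
  simp [boltzmannWeight, complexWeight]

theorem complexWeight_halfEdgeGraph {N : ℕ} {E : Type} [Fintype E]
    (φ : E × Bool ≃ Fin N × Bool) (β : ℝ) (z : ℂ) (σ : SpinConfig N) :
    complexWeight (halfEdgeGraph φ) β z σ
      = (∏ e, if σ (φ (e, false)).1 = σ (φ (e, true)).1 then Complex.exp β else Complex.exp (-β)) *
        ∏ v, if σ v = 1 then Complex.exp z else Complex.exp (-z) := by
  have hu : (-1 : ℤˣ) ≠ 1 := by decide
  have hu' : (1 : ℤˣ) ≠ -1 := by decide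
  rw [complexWeight, edgeSum_halfEdgeGraph, Complex.exp_add, totalSpin]
  push_cast
  rw [Finset.mul_sum, Finset.mul_sum, Complex.exp_sum, Complex.exp_sum]
  congr 1
  · refine Finset.prod_congr rfl fun e _ => ?_
    simp only [spin]
    rcases Int.units_eq_one_or (σ (φ (e, false)).1) with h | h <;>
    rcases Int.units_eq_one_or (σ (φ (e, true)).1) with h' | h' <;>
      simp [h, h', hu, hu']
  · refine Finset.prod_congr rfl fun v _ => ?_
    simp only [spin]
    rcases Int.units_eq_one_or (σ v) with h | h <;> simp [h, hu]

theorem boltzmannWeight_halfEdgeGraph {N : ℕ} {E : Type} [Fintype E]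
    (φ : E × Bool ≃ Fin N × Bool) (β b : ℝ) (σ : SpinConfig N) :
    boltzmannWeight (halfEdgeGraph φ) β b σ
      = (∏ e, if σ (φ (e, false)).1 = σ (φ (e, true)).1 then Real.exp β else Real.exp (-β)) *
        ∏ v, if σ v = 1 then Real.exp b else Real.exp (-b) := by
  have h := complexWeight_halfEdgeGraph φ β b σ
  rw [← ofReal_boltzmannWeight] at h
  apply Complex.ofReal_injective
  rw [h]
  push_cast
  congr 1 <;> refine Finset.prod_congr rfl fun _ _ => ?_ <;> split_ifs <;> simp

/-- Half of the difference of the two real transfer matrix eigenvalues. -/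
def halfGap (β b : ℝ) : ℝ := √(Real.exp β ^ 2 * Real.sinh b ^ 2 + Real.exp (-β) ^ 2)

/-- Half of the difference of the two transfer matrix eigenvalues for a complex field. -/
def complexHalfGap (β : ℝ) (z : ℂ) : ℂ :=
  (Complex.exp β ^ 2 * Complex.sinh z ^ 2 + Complex.exp (-β) ^ 2) ^ (1 / 2 : ℂ)

/-- The eigenvalues of the transfer matrix; `false` stands for the larger one. -/
def eigenvalue (β b : ℝ) (t : Bool) : ℝ :=
  transferEigenvalue (Real.exp β) (Real.exp b) (Real.exp (-b)) (halfGap β b) t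

/-- The eigenvalues of the transfer matrix for a complex field. -/
def complexEigenvalue (β : ℝ) (z : ℂ) (t : Bool) : ℂ :=
  transferEigenvalue (Complex.exp β) (Complex.exp z) (Complex.exp (-z)) (complexHalfGap β z) t

theorem halfGap_pos (β b : ℝ) : 0 < halfGap β b := Real.sqrt_pos.2 (by positivity)

theorem halfGap_sq (β b : ℝ) :
    halfGap β b ^ 2 = Real.exp β ^ 2 * Real.sinh b ^ 2 + Real.exp (-β) ^ 2 :=
  Real.sq_sqrt (by positivity)

theorem complexHalfGap_sq (β : ℝ) (z : ℂ) :
    complexHalfGap β z ^ 2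
      = Complex.exp β ^ 2 * Complex.sinh z ^ 2 + Complex.exp (-β) ^ 2 := by
  rw [complexHalfGap, one_div]
  exact Complex.cpow_nat_inv_pow _ two_ne_zero

theorem complexHalfGap_ofReal (β b : ℝ) : complexHalfGap β b = halfGap β b := by
  rw [complexHalfGap, halfGap, Real.sqrt_eq_rpow, Complex.ofReal_cpow (by positivity)]
  push_cast
  rfl

theorem complexEigenvalue_ofReal (β b : ℝ) (t : Bool) :
    complexEigenvalue β b t = eigenvalue β b t := by
  rw [complexEigenvalue, eigenvalue, complexHalfGap_ofReal, transferEigenvalue,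
    transferEigenvalue]
  cases t <;> simp

theorem eigenvalue_false (β b : ℝ) :
    eigenvalue β b false = Real.exp β * Real.cosh b + halfGap β b := by
  rw [eigenvalue, transferEigenvalue, Real.cosh_eq]
  simp only [cond_false]
  ring

theorem eigenvalue_true (β b : ℝ) :
    eigenvalue β b true = Real.exp β * Real.cosh b - halfGap β b := by
  rw [eigenvalue, transferEigenvalue, Real.cosh_eq]
  simp only [cond_true]
  ring

theorem complexEigenvalue_false (β : ℝ) (z : ℂ) :
    complexEigenvalue β z false = Complex.exp β * Complex.cosh z + complexHalfGap β z := by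
  rw [complexEigenvalue, transferEigenvalue, Complex.cosh]
  simp only [cond_false]
  ring

theorem complexEigenvalue_true (β : ℝ) (z : ℂ) :
    complexEigenvalue β z true = Complex.exp β * Complex.cosh z - complexHalfGap β z := by
  rw [complexEigenvalue, transferEigenvalue, Complex.cosh]
  simp only [cond_true]
  ring

open scoped Classical in
theorem complexPartition_halfEdgeGraph {N : ℕ} {E : Type} [Fintype E]
    (φ : E × Bool ≃ Fin N × Bool) (β : ℝ) {z : ℂ} (hz : complexHalfGap β z ≠ 0) :
    complexPartition (halfEdgeGraph φ) β z
      = ∑ y : Fin N → Bool, if IsMono φ y then ∏ v, complexEigenvalue β z (y v) else 0 := by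
  rw [complexPartition, Finset.sum_congr rfl fun σ _ => complexWeight_halfEdgeGraph φ β z σ]
  refine sum_ising_eq_sum_mono φ
    (show Complex.exp z * Complex.exp (-z) = 1 by
      rw [← Complex.exp_add, add_neg_cancel, Complex.exp_zero]) (Complex.exp_ne_zero _) hz ?_
  rw [complexHalfGap_sq, Complex.sinh]
  ring

/-- A monochromatic colouring picks one eigenvalue per component, so each factor is the trace of a
power of the transfer matrix. -/
theorem partitionFunction_halfEdgeGraph {N : ℕ} {E : Type} [Fintype E]
    (φ : E × Bool ≃ Fin N × Bool) (β b : ℝ) :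
    partitionFunction (halfEdgeGraph φ) β b
      = ∏ k : Component φ, (eigenvalue β b false ^ k.size + eigenvalue β b true ^ k.size) := by
  classical
  have h := sum_mono_eq_prod_component φ (eigenvalue β b)
  simp_rw [Fintype.sum_bool, add_comm (eigenvalue β b true ^ _)] at h
  rw [← h, partitionFunction,
    Finset.sum_congr rfl fun σ _ => boltzmannWeight_halfEdgeGraph φ β b σ]
  refine sum_ising_eq_sum_mono φ
    (show Real.exp b * Real.exp (-b) = 1 by
      rw [← Real.exp_add, add_neg_cancel, Real.exp_zero]) (Real.exp_ne_zero _)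
    (halfGap_pos β b).ne' ?_
  rw [halfGap_sq, Real.sinh_eq]
  ring

/-! ### Configurations of the model as 2-regular multigraphs -/

/-- The half-edges of a 2-regular degree sequence. -/
def halfEdgeEquiv (N : ℕ) : HalfEdge (fun _ : Fin N => 2) ≃ Fin N × Bool :=
  (Equiv.sigmaEquivProd _ _).trans (Equiv.prodCongr (Equiv.refl _) finTwoEquiv)

/-- Choosing an order on each unordered pair labels the two ends of every edge. The second clause
states monochromaticity through the pairing itself, where it can be counted. -/
theorem Pairing.exists_eq_halfEdgeGraph {N : ℕ} (π : Pairing fun _ : Fin N => 2) :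
    ∃ (E : Type) (_ : Fintype E) (φ : E × Bool ≃ Fin N × Bool),
      π.toMultigraph = halfEdgeGraph φ ∧
      ∀ {T : Type} (y : Fin N → T), IsMono φ y ↔ ∀ h, y (π.1 h).1 = y h.1 := by
  classical
  let s : Finset (Sym2 (HalfEdge fun _ : Fin N => 2)) :=
    Finset.univ.image fun h => s(h, π.1 h)
  have hout : ∀ e : s, s((Quot.out e.1).1, (Quot.out e.1).2) = e.1 := fun e => Quot.out_eq _
  have hπ : ∀ e : s, π.1 (Quot.out e.1).1 = (Quot.out e.1).2 := by
    intro e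
    obtain ⟨h, -, he⟩ := Finset.mem_image.1 e.2
    have := hout e
    rw [← he, Sym2.eq_iff] at this
    rw [← he]
    rcases this with ⟨h1, h2⟩ | ⟨h1, h2⟩
    · rw [h1, h2]
    · rw [h1, h2, (π.2 h).2]
  let f : s × Bool → HalfEdge fun _ : Fin N => 2 :=
    fun p => bif p.2 then (Quot.out p.1.1).2 else (Quot.out p.1.1).1
  have hs : ∀ p, s(f p, π.1 (f p)) = p.1.1 := by
    rintro ⟨e, _ | _⟩
    · simp only [f, cond_false]
      rw [hπ, hout]
    · simp only [f, cond_true]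
      rw [← hπ, (π.2 _).2, Sym2.eq_swap, hπ, hout]
  have hf : Function.Bijective f := by
    constructor
    · intro p p' h
      have h1 : p.1 = p'.1 := Subtype.ext (by rw [← hs p, ← hs p', h])
      obtain ⟨e, b⟩ := p
      obtain ⟨e', b'⟩ := p'
      simp only at h1
      subst h1
      have hne := (π.2 (Quot.out e.1).1).1
      rw [hπ] at hne
      cases b <;> cases b' <;> simp_all [f]
    · intro h
      let e : s := ⟨s(h, π.1 h), Finset.mem_image_of_mem _ (Finset.mem_univ _)⟩
      have := hout e
      rw [Sym2.eq_iff] at this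
      rcases this with ⟨h1, h2⟩ | ⟨h1, h2⟩
      · exact ⟨(e, false), h1⟩
      · exact ⟨(e, true), h2⟩
  let φ : s × Bool ≃ Fin N × Bool := (Equiv.ofBijective f hf).trans (halfEdgeEquiv N)
  have hφ : ∀ p, (φ p).1 = (f p).1 := fun _ => rfl
  refine ⟨s, inferInstance, φ, ?_, ?_⟩
  · rw [Pairing.toMultigraph, halfEdgeGraph]
    congr 1
    change s.val.map _ = _
    have hval : s.val = (Finset.univ : Finset s).val.map Subtype.val := by
      rw [Finset.univ_eq_attach, Finset.attach_val, Multiset.attach_map_val]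
    conv_lhs => rw [hval, Multiset.map_map]
    refine Multiset.map_congr rfl fun e _ => ?_
    simp only [Function.comp, hφ, f, cond_true, cond_false]
    conv_lhs => rw [← hout e]
    rfl
  · intro T y
    constructor
    · intro hy h
      obtain ⟨⟨e, b⟩, rfl⟩ := hf.2 h
      have he := hy e
      rw [hφ, hφ] at he
      simp only [f, cond_true, cond_false] at he
      cases b
      · simp only [f, cond_false]
        rw [hπ, he]
      · simp only [f, cond_true]
        rw [← hπ, (π.2 _).2, hπ, he]
    · intro hy e
      rw [hφ, hφ]
      simp only [f, cond_true, cond_false]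
      rw [← hπ, hy]

instance {N : ℕ} (d : Fin N → ℕ) : Fintype (Pairing d) := Fintype.ofFinite _

theorem integral_twoRegularCM {N : ℕ} (f : Multigraph (Fin N) → ℝ) :
    ∫ G, f G ∂twoRegularCM N = (Fintype.card (Pairing fun _ : Fin N => 2) : ℝ)⁻¹ *
      ∑ π : Pairing fun _ : Fin N => 2, f π.toMultigraph := by
  rw [twoRegularCM, configurationModel, integral_map measurable_from_top.aemeasurable
    measurable_from_top.aestronglyMeasurable, uniformOn, ProbabilityTheory.cond,
    Measure.restrict_univ, integral_smul_measure, integral_count]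
  simp

/-! ### Counting pairings -/

/-- Fixed-point free involutions. -/
abbrev FreeInvolution (α : Type*) : Type _ :=
  {π : Equiv.Perm α // ∀ h, π h ≠ h ∧ π (π h) = h}

instance (α : Type*) [Finite α] : Fintype (FreeInvolution α) := Fintype.ofFinite _

theorem cycleType_eq_replicate_two_iff {α : Type*} [Fintype α] [DecidableEq α] {n : ℕ}
    (hα : Fintype.card α = 2 * n) (π : Equiv.Perm α) :
    π.cycleType = Multiset.replicate n 2 ↔ ∀ h, π h ≠ h ∧ π (π h) = h := by
  constructor
  · intro h
    have h1 : π ^ 2 = 1 := Equiv.Perm.pow_prime_eq_one_iff.2 fun c hc => by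
      rw [h] at hc
      exact Multiset.eq_of_mem_replicate hc
    have h2 : π.support = Finset.univ := by
      rw [← Finset.card_eq_iff_eq_univ, ← Equiv.Perm.sum_cycleType, h, hα]
      simp [mul_comm]
    refine fun x => ⟨?_, ?_⟩
    · rw [← Equiv.Perm.mem_support, h2]
      exact Finset.mem_univ _
    · rw [← Equiv.Perm.mul_apply, ← pow_two, h1, Equiv.Perm.one_apply]
  · intro h
    have h1 : π ^ 2 = 1 := by
      ext x
      rw [pow_two, Equiv.Perm.mul_apply, (h x).2, Equiv.Perm.one_apply]
    have h2 : π.support = Finset.univ := by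
      ext x
      simp [(h x).1]
    have h3 := Equiv.Perm.pow_prime_eq_one_iff.1 h1
    have h4 := Multiset.eq_replicate_of_mem h3
    have h5 := π.sum_cycleType
    rw [h2, Finset.card_univ, hα, h4] at h5
    simp only [Multiset.sum_replicate, smul_eq_mul] at h5
    rw [h4]
    congr 1
    omega

/-- These involutions form the conjugacy class of cycle type `2 ^ n`, whose centralizer has order `2
^ n * n!`. -/
theorem card_freeInvolution (α : Type*) [Fintype α] {n : ℕ} (hα : Fintype.card α = 2 * n) :
    Fintype.card (FreeInvolution α) * (2 ^ n * n.factorial) = (2 * n).factorial := by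
  classical
  have h := Equiv.Perm.card_of_cycleType_mul_eq α (Multiset.replicate n 2)
  rw [if_pos ⟨by simp [hα, mul_comm], fun a ha => (Multiset.eq_of_mem_replicate ha).ge⟩] at h
  have hc : Fintype.card (FreeInvolution α)
      = (Finset.univ.filter fun π : Equiv.Perm α => π.cycleType = Multiset.replicate n 2).card := by
    rw [← Fintype.card_subtype]
    exact Fintype.card_congr (Equiv.subtypeEquivRight fun π =>
      (cycleType_eq_replicate_two_iff hα π).symm)
  rw [hc, ← hα, ← h]
  congr 1
  -- For `n = 0` the cycle type is empty, so 2 is not among its elements.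
  rcases Nat.eq_zero_or_pos n with rfl | hn
  · simp [hα]
  · rw [Multiset.toFinset_replicate, if_neg hn.ne']
    simp [hα, mul_comm n 2]

/-- A fixed-point free involution that preserves a predicate splits into two. -/
def freeInvolutionPreservingEquiv {α : Type*} (p : α → Prop) [DecidablePred p] :
    {π : FreeInvolution α // ∀ h, p (π.1 h) ↔ p h} ≃
      FreeInvolution {h // p h} × FreeInvolution {h // ¬ p h} where
  toFun π := (⟨π.1.1.subtypePerm π.2, fun h => ⟨fun e => (π.1.2 h).1 (congrArg Subtype.val e),
      Subtype.ext (π.1.2 h).2⟩⟩,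
    ⟨π.1.1.subtypePerm fun h => not_congr (π.2 h),
      fun h => ⟨fun e => (π.1.2 h).1 (congrArg Subtype.val e), Subtype.ext (π.1.2 h).2⟩⟩)
  invFun q := ⟨⟨Equiv.Perm.subtypeCongr q.1.1 q.2.1, fun h => by
    by_cases hp : p h
    · rw [Equiv.Perm.subtypeCongr.left_apply _ _ hp,
        Equiv.Perm.subtypeCongr.left_apply_subtype, (q.1.2 ⟨h, hp⟩).2]
      exact ⟨fun e => (q.1.2 ⟨h, hp⟩).1 (Subtype.ext e), rfl⟩
    · rw [Equiv.Perm.subtypeCongr.right_apply _ _ hp,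
        Equiv.Perm.subtypeCongr.right_apply_subtype, (q.2.2 ⟨h, hp⟩).2]
      exact ⟨fun e => (q.2.2 ⟨h, hp⟩).1 (Subtype.ext e), rfl⟩⟩, fun h => by
    by_cases hp : p h
    · simp only [Equiv.Perm.subtypeCongr.left_apply _ _ hp, hp, iff_true]
      exact (q.1.1 ⟨h, hp⟩).2
    · simp only [Equiv.Perm.subtypeCongr.right_apply _ _ hp, hp, iff_false]
      exact (q.2.1 ⟨h, hp⟩).2⟩
  left_inv π := by
    ext h
    by_cases hp : p h
    · simp [Equiv.Perm.subtypeCongr.left_apply _ _ hp]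
    · simp [Equiv.Perm.subtypeCongr.right_apply _ _ hp]
  right_inv q := by
    ext h
    · simp
    · simp

/-- The probability that a symmetric random walk is at `0` after `2n` steps. -/
def returnProb (n : ℕ) : ℝ := n.centralBinom / 4 ^ n

theorem returnProb_pos (n : ℕ) : 0 < returnProb n :=
  div_pos (Nat.cast_pos.2 n.centralBinom_pos) (by positivity)

/-- In this form of `(2n - 1)!!`, the powers of 2 and factorials from two colour classes combine
with a binomial coefficient and cancel, leaving only return probabilities. -/
theorem card_freeInvolution_eq (α : Type*) [Fintype α] {n : ℕ} (hα : Fintype.card α = 2 * n) :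
    (Fintype.card (FreeInvolution α) : ℝ) = 2 ^ n * n.factorial * returnProb n := by
  have h := card_freeInvolution α hα
  have h1 := Nat.centralBinom_eq_two_mul_choose n
  have h2 := Nat.choose_mul_factorial_mul_factorial (n := 2 * n) (k := n) (by omega)
  rw [← h1, two_mul, Nat.add_sub_cancel, ← two_mul, ← h] at h2
  have h3 : (n.centralBinom : ℝ) * n.factorial * n.factorial
      = Fintype.card (FreeInvolution α) * (2 ^ n * n.factorial) := by exact_mod_cast h2
  have hf : (n.factorial : ℝ) ≠ 0 := by positivity
  have h4 : (4 : ℝ) ^ n = 2 ^ n * 2 ^ n := by rw [← mul_pow]; norm_num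
  rw [returnProb, h4]
  field_simp
  have h5 : ((n.centralBinom : ℝ) * n.factorial) * n.factorial
      = (Fintype.card (FreeInvolution α) * 2 ^ n) * n.factorial := by linarith
  have := mul_right_cancel₀ hf h5
  linarith

theorem card_pairing (N : ℕ) :
    (Fintype.card (Pairing fun _ : Fin N => 2) : ℝ) = 2 ^ N * N.factorial * returnProb N := by
  rw [← card_freeInvolution_eq (HalfEdge fun _ : Fin N => 2) (by simp [mul_comm])]
  exact congrArg _ (Fintype.card_congr (Equiv.refl _))

-- A preserving pairing consists of separate pairings of the `2k` and `2(N - k)` half-edges of the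
-- two colours. The binomial factor is the number of colourings with the same `k`.
open scoped Classical in
theorem card_pairing_preserving {N : ℕ} (y : Fin N → Bool) :
    ((Finset.univ.filter fun π : Pairing (fun _ : Fin N => 2) =>
        ∀ h, y (π.1 h).1 = y h.1).card : ℝ) * N.choose (Finset.univ.filter (y · = true)).card
      = Fintype.card (Pairing fun _ : Fin N => 2) *
        (returnProb (Finset.univ.filter (y · = true)).card *
          returnProb (N - (Finset.univ.filter (y · = true)).card) / returnProb N) := by
  obtain ⟨k, hk⟩ : ∃ k, k = (Finset.univ.filter (y · = true)).card := ⟨_, rfl⟩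
  have hkN : k ≤ N := by
    rw [hk]
    exact (Finset.card_le_univ _).trans (by simp)
  rw [← hk]
  let p : HalfEdge (fun _ : Fin N => 2) → Prop := fun h => y h.1 = true
  have h1 : Fintype.card {h // p h} = 2 * k := by
    have : Fintype.card {h // p h} = Fintype.card ({v // y v = true} × Fin 2) :=
      Fintype.card_congr ⟨fun h => (⟨h.1.1, h.2⟩, h.1.2), fun q => ⟨⟨q.1.1, q.2⟩, q.1.2⟩,
        fun _ => rfl, fun _ => rfl⟩
    rw [this, Fintype.card_prod, Fintype.card_subtype, Fintype.card_fin, hk, mul_comm]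
  have h2 : Fintype.card {h // ¬ p h} = 2 * (N - k) := by
    rw [Fintype.card_subtype_compl, h1]
    simp
    omega
  have h3 : (Finset.univ.filter fun π : Pairing (fun _ : Fin N => 2) =>
      ∀ h, y (π.1 h).1 = y h.1).card
      = Fintype.card (FreeInvolution {h // p h}) * Fintype.card (FreeInvolution {h // ¬ p h}) := by
    rw [← Fintype.card_prod, ← Fintype.card_subtype]
    refine Fintype.card_congr (Equiv.trans (Equiv.subtypeEquivRight fun π => ?_)
      (freeInvolutionPreservingEquiv p))
    refine forall_congr' fun h => ?_
    simp only [p]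
    cases y (π.1 h).1 <;> cases y h.1 <;> simp
  rw [h3, card_pairing, Nat.cast_mul, card_freeInvolution_eq _ h1, card_freeInvolution_eq _ h2]
  have h4 : (N.choose k : ℝ) * k.factorial * (N - k).factorial = N.factorial := by
    exact_mod_cast Nat.choose_mul_factorial_mul_factorial hkN
  have h5 : (2 : ℝ) ^ k * 2 ^ (N - k) = 2 ^ N := by
    rw [← pow_add, Nat.add_sub_cancel' hkN]
  have := (returnProb_pos N).ne'
  rw [← h4, ← h5]
  field_simp

open scoped Classical in
/-- The mean, over the pairings, of the generating function of the monochromatic colourings. -/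
theorem sum_pairing_sum_mono {R : Type*} [Field R] [Algebra ℝ R] (N : ℕ) (l : Bool → R) :
    ∑ π : Pairing (fun _ : Fin N => 2), ∑ y : Fin N → Bool,
        (if ∀ h, y (π.1 h).1 = y h.1 then ∏ v, l (y v) else 0)
      = algebraMap ℝ R (Fintype.card (Pairing fun _ : Fin N => 2)) *
        ∑ k ∈ Finset.range (N + 1), l true ^ k * l false ^ (N - k) *
          algebraMap ℝ R (returnProb k * returnProb (N - k) / returnProb N) := by
  rw [Finset.sum_comm]
  let c : Finset (Fin N) → R := fun s => l true ^ s.card * l false ^ (N - s.card) *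
    algebraMap ℝ R (Fintype.card (Pairing fun _ : Fin N => 2) * (returnProb s.card *
      returnProb (N - s.card) / returnProb N) / N.choose s.card)
  have h1 : ∀ y : Fin N → Bool, ∑ π : Pairing (fun _ : Fin N => 2),
      (if ∀ h, y (π.1 h).1 = y h.1 then ∏ v, l (y v) else 0)
      = c (Finset.univ.filter (y · = true)) := by
    intro y
    have hle : (Finset.univ.filter (y · = true)).card ≤ N :=
      (Finset.card_le_univ _).trans (by simp)
    have hc : (N.choose (Finset.univ.filter (y · = true)).card : ℝ) ≠ 0 :=
      Nat.cast_ne_zero.2 (Nat.choose_pos hle).ne'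
    have hl : ∏ v, l (y v) = l true ^ (Finset.univ.filter (y · = true)).card *
        l false ^ (N - (Finset.univ.filter (y · = true)).card) := by
      have hf : (Finset.univ.filter fun v => ¬ (y v = true)).card
          = N - (Finset.univ.filter (y · = true)).card := by
        have := Finset.card_filter_add_card_filter_not (s := Finset.univ) (y · = true)
        rw [Finset.card_univ, Fintype.card_fin] at this
        omega
      rw [← hf, ← Finset.prod_filter_mul_prod_filter_not Finset.univ (y · = true)]
      congr 1
      · exact Finset.prod_eq_pow_card fun v hv => by rw [(Finset.mem_filter.1 hv).2]
      · refine Finset.prod_eq_pow_card fun v hv => ?_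
        rw [Bool.eq_false_of_not_eq_true (Finset.mem_filter.1 hv).2]
    rw [← Finset.sum_filter, Finset.sum_const, hl, nsmul_eq_mul, mul_comm]
    simp only [c]
    rw [← card_pairing_preserving y, mul_div_cancel_right₀ _ hc, map_natCast]
  rw [Finset.sum_congr rfl fun y _ => h1 y]
  have h2 : ∑ y : Fin N → Bool, c (Finset.univ.filter (y · = true))
      = ∑ s : Finset (Fin N), c s := by
    refine Fintype.sum_equiv ⟨fun y => Finset.univ.filter (y · = true), fun s v => decide (v ∈ s),
      fun y => ?_, fun s => ?_⟩ _ _ fun _ => rfl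
    · funext v
      simp
    · ext v
      simp
  rw [h2, ← Finset.powerset_univ, Finset.sum_powerset, Finset.card_univ, Fintype.card_fin,
    Finset.mul_sum]
  refine Finset.sum_congr rfl fun k hk => ?_
  have hkN : k ≤ N := Nat.lt_succ_iff.1 (Finset.mem_range.1 hk)
  have h3 : ∀ s ∈ Finset.powersetCard k (Finset.univ : Finset (Fin N)),
      c s = l true ^ k * l false ^ (N - k) *
    algebraMap ℝ R (Fintype.card (Pairing fun _ : Fin N => 2) * (returnProb k *
      returnProb (N - k) / returnProb N) / N.choose k) := fun s hs => by
    simp only [c, (Finset.mem_powersetCard.1 hs).2]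
  -- The number of `k`-sets cancels the binomial denominator in `c`.
  rw [Finset.sum_congr rfl h3, Finset.sum_const, Finset.card_powersetCard, Finset.card_univ,
    Fintype.card_fin, nsmul_eq_mul, mul_left_comm, ← map_natCast (algebraMap ℝ R), ← map_mul,
    mul_div_cancel₀ _ (Nat.cast_ne_zero.2 (Nat.choose_pos hkN).ne'), map_mul]
  ring

/-- The polynomial of `r` that is the mean of `∏ (1 + r ^ L)` over the cycle lengths `L`. -/
def cyclePolynomial {R : Type*} [Field R] [Algebra ℝ R] (N : ℕ) (r : R) : R :=
  ∑ k ∈ Finset.range (N + 1), r ^ k *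
    algebraMap ℝ R (returnProb k * returnProb (N - k) / returnProb N)

-- This is the annealed partition function up to normalization, with the dominant eigenvalue
-- factored out. The complex field is what the characteristic function needs.
open scoped Classical in
theorem sum_complexPartition (N : ℕ) (β : ℝ) {z : ℂ} (hz : complexHalfGap β z ≠ 0)
    (h0 : complexEigenvalue β z false ≠ 0) :
    ∑ π : Pairing (fun _ : Fin N => 2), complexPartition π.toMultigraph β z
      = Fintype.card (Pairing fun _ : Fin N => 2) * (complexEigenvalue β z false ^ N *
        cyclePolynomial N (complexEigenvalue β z true / complexEigenvalue β z false)) := by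
  have h : ∀ π : Pairing (fun _ : Fin N => 2), complexPartition π.toMultigraph β z
      = ∑ y : Fin N → Bool,
        (if ∀ h, y (π.1 h).1 = y h.1 then ∏ v, complexEigenvalue β z (y v) else 0) := by
    intro π
    obtain ⟨E, _, φ, h1, h2⟩ := π.exists_eq_halfEdgeGraph
    rw [h1, complexPartition_halfEdgeGraph φ β hz]
    simp_rw [h2]
  rw [Finset.sum_congr rfl fun π _ => h π, sum_pairing_sum_mono, cyclePolynomial]
  simp only [Complex.coe_algebraMap, Complex.ofReal_natCast]
  congr 1
  rw [Finset.mul_sum]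
  refine Finset.sum_congr rfl fun k hk => ?_
  have hkN : k ≤ N := Nat.lt_succ_iff.1 (Finset.mem_range.1 hk)
  rw [← mul_assoc, div_pow]
  congr 1
  conv_rhs => rw [← Nat.add_sub_cancel' hkN, pow_add]
  field_simp

/-! ### Asymptotics of the mean over the pairings -/

theorem returnProb_zero : returnProb 0 = 1 := by simp [returnProb]

theorem returnProb_succ (n : ℕ) :
    returnProb (n + 1) = returnProb n * ((2 * n + 1) / (2 * n + 2)) := by
  have h : ((n : ℝ) + 1) * (n + 1).centralBinom = 2 * (2 * n + 1) * n.centralBinom := by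
    exact_mod_cast n.succ_mul_centralBinom_succ
  have h1 : ((n : ℝ) + 1) ≠ 0 := by positivity
  rw [returnProb, returnProb, pow_succ]
  field_simp
  linarith

/-- The ratio `p_(n+1) / p_n = (2n + 1) / (2n + 2)` increases with `n`. This bounds the split
coefficients by 1. -/
theorem returnProb_mul_le (k m : ℕ) : returnProb k * returnProb m ≤ returnProb (k + m) := by
  induction k with
  | zero => simp [returnProb_zero]
  | succ k ih =>
    rw [Nat.succ_add, returnProb_succ, returnProb_succ, mul_right_comm]
    refine mul_le_mul ih ?_ (by positivity) (returnProb_pos _).le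
    push_cast
    rw [div_le_div_iff₀ (by positivity) (by positivity)]
    nlinarith [Nat.cast_nonneg (α := ℝ) k, Nat.cast_nonneg (α := ℝ) m]

/-- The mean number of sets of `k` vertices that are unions of cycles of the 2-regular
configuration model on `N` vertices. -/
def splitCoeff (N k : ℕ) : ℝ := returnProb k * returnProb (N - k) / returnProb N

theorem splitCoeff_nonneg (N k : ℕ) : 0 ≤ splitCoeff N k :=
  div_nonneg (mul_nonneg (returnProb_pos _).le (returnProb_pos _).le) (returnProb_pos _).le

theorem splitCoeff_le_one {N k : ℕ} (hk : k ≤ N) : splitCoeff N k ≤ 1 := by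
  rw [splitCoeff, div_le_one (returnProb_pos _)]
  simpa [Nat.add_sub_cancel' hk] using returnProb_mul_le k (N - k)

theorem tendsto_returnProb_div (k : ℕ) :
    Tendsto (fun n => returnProb n / returnProb (n + k)) atTop (𝓝 1) := by
  induction k with
  | zero => simp [div_self (returnProb_pos _).ne']
  | succ k ih =>
    have h : Tendsto (fun n : ℕ => ((2 * (n + k : ℕ) + 1 : ℝ) / (2 * (n + k : ℕ) + 2))⁻¹) atTop
        (𝓝 1) := by
      have h2 : Tendsto (fun n : ℕ => (1 : ℝ) - 1 / ((n + k : ℕ) + 1) / 2) atTop (𝓝 (1 - 0 / 2)) :=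
        tendsto_const_nhds.sub (((tendsto_one_div_add_atTop_nhds_zero_nat (𝕜 := ℝ)).comp
          (tendsto_add_atTop_nat k)).div_const 2)
      rw [← inv_one]
      refine Tendsto.inv₀ ?_ one_ne_zero
      rw [zero_div, sub_zero] at h2
      refine h2.congr fun n => ?_
      have : ((n + k : ℕ) : ℝ) + 1 ≠ 0 := by positivity
      field_simp
      ring
    have h3 := ih.mul h
    rw [mul_one] at h3
    refine h3.congr fun n => ?_
    rw [← add_assoc, returnProb_succ, div_mul_eq_div_div, div_eq_mul_inv _ ((2 * _ + 1) / _)]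

theorem tendsto_splitCoeff (k : ℕ) :
    Tendsto (fun N => splitCoeff N k) atTop (𝓝 (returnProb k)) := by
  rw [← tendsto_add_atTop_iff_nat k]
  have h := (tendsto_returnProb_div k).const_mul (returnProb k)
  rw [mul_one] at h
  refine h.congr fun n => ?_
  rw [splitCoeff, Nat.add_sub_cancel, mul_div_assoc]

theorem cyclePolynomial_complex (N : ℕ) (r : ℂ) :
    cyclePolynomial N r = ∑ k ∈ Finset.range (N + 1), r ^ k * (splitCoeff N k : ℂ) := rfl

theorem cyclePolynomial_real (N : ℕ) (r : ℝ) :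
    cyclePolynomial N r = ∑ k ∈ Finset.range (N + 1), r ^ k * splitCoeff N k := rfl

theorem cyclePolynomial_ofReal (N : ℕ) (r : ℝ) :
    cyclePolynomial N (r : ℂ) = (cyclePolynomial N r : ℝ) := by
  rw [cyclePolynomial_complex, cyclePolynomial_real]
  push_cast
  rfl

/-- Dominated convergence: the coefficients are at most 1 and converge termwise, and `‖r N‖` is
eventually below some `ρ < 1`. The argument varies with `N` because the field will be `B + i s /
√N`. -/
theorem tendsto_cyclePolynomial {r : ℕ → ℂ} {r₀ : ℂ} (hr : Tendsto r atTop (𝓝 r₀))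
    (h1 : ‖r₀‖ < 1) :
    Tendsto (fun N => cyclePolynomial N (r N)) atTop
      (𝓝 (∑' k, r₀ ^ k * (returnProb k : ℂ))) := by
  obtain ⟨ρ, hρ, hρ1⟩ := exists_between h1
  have hρ0 : 0 ≤ ρ := (norm_nonneg _).trans hρ.le
  have hf : ∀ N, cyclePolynomial N (r N)
      = ∑' k, if k ∈ Finset.range (N + 1) then r N ^ k * (splitCoeff N k : ℂ) else 0 := by
    intro N
    rw [cyclePolynomial_complex, tsum_eq_sum (s := Finset.range (N + 1))
      fun k hk => if_neg hk]
    exact Finset.sum_congr rfl fun k hk => (if_pos hk).symm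
  simp_rw [hf]
  refine tendsto_tsum_of_dominated_convergence (bound := fun k => ρ ^ k)
    (summable_geometric_of_lt_one hρ0 hρ1) (fun k => ?_) ?_
  · refine ((hr.pow k).mul (Complex.continuous_ofReal.tendsto _ |>.comp
      (tendsto_splitCoeff k))).congr' ?_
    filter_upwards [eventually_ge_atTop k] with N hN
    rw [if_pos (Finset.mem_range.2 (Nat.lt_succ_of_le hN))]
    rfl
  · filter_upwards [hr.norm.eventually_lt_const hρ] with N hN k
    split_ifs with hk
    · rw [norm_mul, norm_pow, Complex.norm_real, Real.norm_of_nonneg (splitCoeff_nonneg _ _)]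
      exact (mul_le_of_le_one_right (by positivity) (splitCoeff_le_one
        (Nat.lt_succ_iff.1 (Finset.mem_range.1 hk)))).trans
        (pow_le_pow_left₀ (norm_nonneg _) hN.le k)
    · rw [norm_zero]
      positivity

theorem one_le_cyclePolynomial (N : ℕ) {r : ℝ} (hr : 0 ≤ r) : 1 ≤ cyclePolynomial N r := by
  have h0 : splitCoeff N 0 = 1 := by
    simp [splitCoeff, returnProb_zero, div_self (returnProb_pos _).ne']
  rw [cyclePolynomial_real, Finset.sum_range_succ', h0]
  simp only [pow_zero, mul_one, le_add_iff_nonneg_left]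
  exact Finset.sum_nonneg fun k _ => mul_nonneg (pow_nonneg hr _) (splitCoeff_nonneg _ _)

theorem cyclePolynomial_one_le (N : ℕ) : cyclePolynomial N (1 : ℝ) ≤ N + 1 := by
  rw [cyclePolynomial_real]
  refine (Finset.sum_le_card_nsmul _ _ 1 fun k hk => ?_).trans (by simp)
  rw [one_pow, one_mul]
  exact splitCoeff_le_one (Nat.lt_succ_iff.1 (Finset.mem_range.1 hk))

theorem hasDerivAt_cyclePolynomial (N : ℕ) (r : ℝ) :
    HasDerivAt (cyclePolynomial N)
      (∑ k ∈ Finset.range (N + 1), k * r ^ (k - 1) * splitCoeff N k) r := by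
  have : (cyclePolynomial N : ℝ → ℝ)
      = fun r => ∑ k ∈ Finset.range (N + 1), r ^ k * splitCoeff N k := rfl
  rw [this]
  exact HasDerivAt.fun_sum fun k _ => (hasDerivAt_pow k r).mul_const _

theorem exists_abs_deriv_cyclePolynomial_le {r : ℝ} (h0 : 0 ≤ r) (h1 : r < 1) :
    ∃ C, ∀ N : ℕ, |∑ k ∈ Finset.range (N + 1), k * r ^ (k - 1) * splitCoeff N k| ≤ C := by
  have hs : Summable fun k : ℕ => (k : ℝ) * r ^ (k - 1) := by
    have h := summable_pow_mul_geometric_of_norm_lt_one 1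
      (show ‖r‖ < 1 by rwa [Real.norm_of_nonneg h0])
    have h' := summable_geometric_of_lt_one h0 h1
    rw [← summable_nat_add_iff 1]
    refine (h.add h').congr fun k => ?_
    simp
    ring
  refine ⟨∑' k : ℕ, (k : ℝ) * r ^ (k - 1), fun N => ?_⟩
  rw [abs_of_nonneg (Finset.sum_nonneg fun k _ =>
    mul_nonneg (by positivity) (splitCoeff_nonneg _ _))]
  refine le_trans (Finset.sum_le_sum fun k hk => ?_)
    (hs.sum_le_tsum (Finset.range (N + 1)) fun k _ => by positivity)
  exact mul_le_of_le_one_right (by positivity)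
    (splitCoeff_le_one (Nat.lt_succ_iff.1 (Finset.mem_range.1 hk)))

/-! ### The eigenvalues -/

theorem eigenvalue_false_pos (β b : ℝ) : 0 < eigenvalue β b false := by
  rw [eigenvalue_false]
  have := halfGap_pos β b
  have := Real.cosh_pos b
  positivity

/-- The product of the eigenvalues is `exp (2β) - exp (-2β)`. The sign of `β` enters the whole proof
only here. -/
theorem eigenvalue_true_nonneg {β : ℝ} (hβ : 0 ≤ β) (b : ℝ) : 0 ≤ eigenvalue β b true := by
  rw [eigenvalue_true, sub_nonneg]
  refine abs_le_of_sq_le_sq' ?_ (by have := Real.cosh_pos b; positivity) |>.2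
  rw [halfGap_sq, mul_pow, Real.cosh_sq]
  have : Real.exp (-β) ≤ Real.exp β := Real.exp_le_exp.2 (by linarith)
  nlinarith [Real.exp_pos (-β)]

/-- The ratio of the eigenvalues. -/
def eigenRatio (β b : ℝ) : ℝ := eigenvalue β b true / eigenvalue β b false

theorem eigenRatio_nonneg {β : ℝ} (hβ : 0 ≤ β) (b : ℝ) : 0 ≤ eigenRatio β b :=
  div_nonneg (eigenvalue_true_nonneg hβ b) (eigenvalue_false_pos β b).le

theorem eigenRatio_lt_one (β b : ℝ) : eigenRatio β b < 1 := by
  rw [eigenRatio, div_lt_one (eigenvalue_false_pos β b), eigenvalue_false, eigenvalue_true]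
  linarith [halfGap_pos β b]

/-- The magnetization of the one-dimensional model. -/
def lineMagnetization (β b : ℝ) : ℝ := Real.exp β * Real.sinh b / halfGap β b

/-- The susceptibility of the one-dimensional model. -/
def lineSusceptibility (β b : ℝ) : ℝ :=
  Real.exp β * Real.exp (-β) ^ 2 * Real.cosh b / halfGap β b ^ 3

theorem lineSusceptibility_pos (β b : ℝ) : 0 < lineSusceptibility β b := by
  have := halfGap_pos β b
  have := Real.cosh_pos b
  rw [lineSusceptibility]
  positivity

theorem lineSusceptibility_eq (β b : ℝ) :
    lineSusceptibility β b = Real.cosh b * Real.exp (-4 * β) /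
      (Real.sinh b ^ 2 + Real.exp (-4 * β)) ^ (3 / 2 : ℝ) := by
  set D := Real.sinh b ^ 2 + Real.exp (-4 * β) with hD
  have hD0 : 0 < D := by positivity
  have h1 : halfGap β b = Real.exp β * √D := by
    rw [halfGap, Real.sqrt_eq_iff_mul_self_eq_of_pos (by positivity), mul_mul_mul_comm,
      Real.mul_self_sqrt hD0.le, hD, mul_add, ← Real.exp_add, ← Real.exp_add, ← Real.exp_nat_mul,
      ← Real.exp_nat_mul]
    congr 2 <;> congr 1 <;> push_cast <;> ring
  have h2 : D ^ (3 / 2 : ℝ) = √D ^ 3 := by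
    rw [Real.sqrt_eq_rpow, ← Real.rpow_natCast, ← Real.rpow_mul hD0.le]
    norm_num
  have h3 : Real.exp β * Real.exp (-β) ^ 2 = Real.exp (-4 * β) * Real.exp β ^ 3 := by
    rw [← Real.exp_nat_mul, ← Real.exp_nat_mul, ← Real.exp_add, ← Real.exp_add]
    congr 1
    push_cast
    ring
  rw [lineSusceptibility, h1, h2, h3, mul_pow]
  have : √D ≠ 0 := (Real.sqrt_pos.2 hD0).ne'
  have := (Real.exp_pos β).ne'
  field_simp

theorem hasDerivAt_halfGap (β b : ℝ) :
    HasDerivAt (halfGap β) (Real.exp β ^ 2 * Real.sinh b * Real.cosh b / halfGap β b) b := by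
  have h : HasDerivAt (fun b => Real.exp β ^ 2 * Real.sinh b ^ 2 + Real.exp (-β) ^ 2)
      (Real.exp β ^ 2 * (((2 : ℕ) : ℝ) * Real.sinh b ^ (2 - 1) * Real.cosh b)) b :=
    (((Real.hasDerivAt_sinh b).pow 2).const_mul _).add_const _
  have h0 : Real.exp β ^ 2 * Real.sinh b ^ 2 + Real.exp (-β) ^ 2 ≠ 0 := by positivity
  refine (h.sqrt h0).congr_deriv ?_
  change _ / (2 * halfGap β b) = _
  have := (halfGap_pos β b).ne'
  field_simp
  push_cast
  ring

theorem hasDerivAt_eigenvalue_false (β b : ℝ) :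
    HasDerivAt (fun b => eigenvalue β b false)
      (lineMagnetization β b * eigenvalue β b false) b := by
  have h := ((Real.hasDerivAt_cosh b).const_mul (Real.exp β)).add (hasDerivAt_halfGap β b)
  rw [show (fun b => eigenvalue β b false) = fun b => Real.exp β * Real.cosh b + halfGap β b from
    funext (eigenvalue_false β)]
  refine h.congr_deriv ?_
  have := (halfGap_pos β b).ne'
  rw [eigenvalue_false, lineMagnetization]
  field_simp
  ring

/-- The determinant of the transfer matrix does not depend on the field, so the two logarithmic
derivatives are opposite. -/
theorem hasDerivAt_eigenvalue_true (β b : ℝ) :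
    HasDerivAt (fun b => eigenvalue β b true)
      (-lineMagnetization β b * eigenvalue β b true) b := by
  have h := ((Real.hasDerivAt_cosh b).const_mul (Real.exp β)).sub (hasDerivAt_halfGap β b)
  rw [show (fun b => eigenvalue β b true) = fun b => Real.exp β * Real.cosh b - halfGap β b from
    funext (eigenvalue_true β)]
  refine h.congr_deriv ?_
  have := (halfGap_pos β b).ne'
  rw [eigenvalue_true, lineMagnetization]
  field_simp
  ring

theorem hasDerivAt_eigenRatio (β b : ℝ) :
    HasDerivAt (eigenRatio β) (-2 * lineMagnetization β b * eigenRatio β b) b := by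
  have h0 := (eigenvalue_false_pos β b).ne'
  refine ((hasDerivAt_eigenvalue_true β b).div (hasDerivAt_eigenvalue_false β b)
    h0).congr_deriv ?_
  rw [eigenRatio]
  field_simp
  ring

theorem hasDerivAt_lineMagnetization (β b : ℝ) :
    HasDerivAt (lineMagnetization β) (lineSusceptibility β b) b := by
  have h0 := (halfGap_pos β b).ne'
  refine (((Real.hasDerivAt_sinh b).const_mul (Real.exp β)).div (hasDerivAt_halfGap β b)
    h0).congr_deriv ?_
  have := halfGap_sq β b
  rw [lineSusceptibility]
  field_simp
  rw [this]
  ring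

/-! ### The quenched susceptibility -/

theorem partitionFunction_pos {N : ℕ} (G : Multigraph (Fin N)) (β b : ℝ) :
    0 < partitionFunction G β b :=
  Finset.sum_pos (fun σ _ => boltzmannWeight_pos G β b σ) Finset.univ_nonempty

theorem hasDerivAt_boltzmannWeight {N : ℕ} (G : Multigraph (Fin N)) (β b : ℝ)
    (σ : SpinConfig N) :
    HasDerivAt (fun b => boltzmannWeight G β b σ) (boltzmannWeight G β b σ * totalSpin σ) b := by
  have h := ((hasDerivAt_mul_const (x := b) (totalSpin σ)).const_add (β * edgeSum G σ)).exp
  exact h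

theorem hasDerivAt_partitionFunction {N : ℕ} (G : Multigraph (Fin N)) (β b : ℝ) :
    HasDerivAt (partitionFunction G β) (∑ σ, boltzmannWeight G β b σ * totalSpin σ) b :=
  HasDerivAt.fun_sum fun σ _ => hasDerivAt_boltzmannWeight G β b σ

theorem magnetization_eq_logDeriv {N : ℕ} (G : Multigraph (Fin N)) (β b : ℝ) :
    magnetization G β b = logDeriv (partitionFunction G β) b / N := by
  rw [magnetization, logDeriv_apply, (hasDerivAt_partitionFunction G β b).deriv]
  congr 1
  rw [Finset.sum_div]
  exact Finset.sum_congr rfl fun σ _ => by ring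

/-- The deviation of the total magnetization of a cycle of length `L` from `L` times the
magnetization of the infinite line. -/
def cycleDeviation (β : ℝ) (L : ℕ) (b : ℝ) : ℝ :=
  -2 * (L * lineMagnetization β b * (eigenRatio β b ^ L / (1 + eigenRatio β b ^ L)))

/-- Opposite logarithmic derivatives give `L * m * (1 - r ^ L) / (1 + r ^ L)`. -/
theorem logDeriv_trace {β : ℝ} (hβ : 0 ≤ β) (L : ℕ) (b : ℝ) :
    logDeriv (fun b => eigenvalue β b false ^ L + eigenvalue β b true ^ L) b
      = L * lineMagnetization β b + cycleDeviation β L b := by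
  have hpow : ∀ (t : Bool) (c : ℝ), HasDerivAt (fun b => eigenvalue β b t) (c * eigenvalue β b t) b →
      HasDerivAt (fun b => eigenvalue β b t ^ L) (L * c * eigenvalue β b t ^ L) b := by
    intro t c h
    refine (h.pow L).congr_deriv ?_
    rcases L with _ | L
    · simp
    · rw [Nat.add_sub_cancel]
      ring
  have h0 := eigenvalue_false_pos β b
  have h1 := eigenvalue_true_nonneg hβ b
  have hd := (hpow _ _ (hasDerivAt_eigenvalue_false β b)).add
    (hpow _ _ (hasDerivAt_eigenvalue_true β b))
  rw [logDeriv_apply]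
  erw [hd.deriv]
  rw [cycleDeviation, eigenRatio, div_pow]
  have h2 : 0 < eigenvalue β b false ^ L + eigenvalue β b true ^ L := by positivity
  have h3 := (pow_pos h0 L).ne'
  have h4 : 1 + eigenvalue β b true ^ L / eigenvalue β b false ^ L
      = (eigenvalue β b false ^ L + eigenvalue β b true ^ L) / eigenvalue β b false ^ L := by
    field_simp
  rw [h4]
  have h5 := h2.ne'
  field_simp
  ring

theorem hasDerivAt_cycleDeviation {β : ℝ} (hβ : 0 ≤ β) (L : ℕ) (b : ℝ) :
    HasDerivAt (cycleDeviation β L)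
      (-2 * (L * lineSusceptibility β b * (eigenRatio β b ^ L / (1 + eigenRatio β b ^ L)) +
        L * lineMagnetization β b * (L * (-2 * lineMagnetization β b) * eigenRatio β b ^ L /
          (1 + eigenRatio β b ^ L) ^ 2))) b := by
  have hr := eigenRatio_nonneg hβ b
  have h1 : (1 + eigenRatio β b ^ L) ≠ 0 := by positivity
  have hp : HasDerivAt (fun b => eigenRatio β b ^ L)
      (L * (-2 * lineMagnetization β b) * eigenRatio β b ^ L) b := by
    refine ((hasDerivAt_eigenRatio β b).pow L).congr_deriv ?_
    rcases L with _ | L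
    · simp
    · rw [Nat.add_sub_cancel]
      ring
  have hq := hp.div (hp.const_add 1) h1
  refine ((((hasDerivAt_lineMagnetization β b).const_mul (L : ℝ)).mul hq).const_mul
    (-2)).congr_deriv ?_
  field_simp
  simp only [Pi.div_apply]
  field_simp
  ring

/-- The derivative is controlled by `L * r ^ L` and `L ^ 2 * r ^ L`, each at most the sum of its
convergent series. Uniformity in `L` makes the total error proportional to the number of components.
-/
theorem exists_abs_deriv_cycleDeviation_le {β : ℝ} (hβ : 0 ≤ β) (b : ℝ) :
    ∃ C, ∀ L : ℕ, |deriv (cycleDeviation β L) b| ≤ C := by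
  have hr := eigenRatio_nonneg hβ b
  have hr1 : ‖eigenRatio β b‖ < 1 := by
    rw [Real.norm_of_nonneg hr]
    exact eigenRatio_lt_one β b
  set r := eigenRatio β b with hr_def
  set m := lineMagnetization β b
  have hχ := lineSusceptibility_pos β b
  set χ := lineSusceptibility β b
  have hs1 := summable_pow_mul_geometric_of_norm_lt_one 1 hr1
  have hs2 := summable_pow_mul_geometric_of_norm_lt_one 2 hr1
  refine ⟨2 * (χ * (∑' n : ℕ, (n : ℝ) ^ 1 * r ^ n) +
    2 * m ^ 2 * ∑' n : ℕ, (n : ℝ) ^ 2 * r ^ n), fun L => ?_⟩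
  have h1 := hs1.le_tsum L fun k _ => by positivity
  have h2 := hs2.le_tsum L fun k _ => by positivity
  rw [(hasDerivAt_cycleDeviation hβ L b).deriv, ← hr_def]
  have hL : 0 ≤ r ^ L := by positivity
  have e1 : r ^ L / (1 + r ^ L) ≤ r ^ L := div_le_self hL (by linarith)
  have e1' : 0 ≤ r ^ L / (1 + r ^ L) := by positivity
  have e2 : r ^ L / (1 + r ^ L) ^ 2 ≤ r ^ L := div_le_self hL (by nlinarith)
  have e2' : 0 ≤ r ^ L / (1 + r ^ L) ^ 2 := by positivity
  set x := r ^ L / (1 + r ^ L)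
  set w := r ^ L / (1 + r ^ L) ^ 2 with hw
  have : -2 * (L * χ * x + L * m * (L * (-2 * m) * r ^ L / (1 + r ^ L) ^ 2))
      = -2 * (χ * (L ^ 1 * x)) + 4 * (m ^ 2 * (L ^ 2 * w)) := by
    rw [hw]; ring
  change |-2 * (L * χ * x + L * m * (L * (-2 * m) * r ^ L / (1 + r ^ L) ^ 2))| ≤ _
  rw [this]
  have f1 : χ * (L ^ 1 * x) ≤ χ * ∑' n : ℕ, (n : ℝ) ^ 1 * r ^ n := by
    gcongr
    exact le_trans (by gcongr) h1
  have f2 : m ^ 2 * (L ^ 2 * w) ≤ m ^ 2 * ∑' n : ℕ, (n : ℝ) ^ 2 * r ^ n := by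
    gcongr
    exact le_trans (by gcongr) h2
  have g1 : 0 ≤ χ * (L ^ 1 * x) := by positivity
  have g2 : 0 ≤ m ^ 2 * (L ^ 2 * w) := by positivity
  rw [abs_le]
  constructor <;> linarith

theorem magnetization_halfEdgeGraph {N : ℕ} (hN : N ≠ 0) {E : Type} [Fintype E]
    (φ : E × Bool ≃ Fin N × Bool) {β : ℝ} (hβ : 0 ≤ β) (b : ℝ) :
    magnetization (halfEdgeGraph φ) β b
      = lineMagnetization β b + (∑ k : Component φ, cycleDeviation β k.size b) / N := by
  have hN' : (N : ℝ) ≠ 0 := Nat.cast_ne_zero.2 hN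
  rw [magnetization_eq_logDeriv, funext (partitionFunction_halfEdgeGraph φ β), logDeriv_prod]
  · simp_rw [logDeriv_trace hβ]
    rw [Finset.sum_add_distrib, ← Finset.sum_mul, ← Nat.cast_sum, Component.sum_size,
      Fintype.card_fin]
    field_simp
  · intro k _
    have h0 := eigenvalue_false_pos β b
    have h1 := eigenvalue_true_nonneg hβ b
    positivity
  · intro k _
    exact ((hasDerivAt_eigenvalue_false β b).pow _).differentiableAt.add
      ((hasDerivAt_eigenvalue_true β b).pow _).differentiableAt

/-- The component sizes add up to `N`, so the main terms give exactly the magnetization of the line;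
each component then costs a bounded error. -/
theorem exists_abs_susceptibility_sub_le {β : ℝ} (hβ : 0 ≤ β) (b : ℝ) :
    ∃ C, 0 < C ∧ ∀ (N : ℕ), N ≠ 0 → ∀ (E : Type) [Fintype E] (φ : E × Bool ≃ Fin N × Bool),
      |susceptibility (halfEdgeGraph φ) β b - lineSusceptibility β b|
        ≤ C * (Fintype.card (Component φ) / N) := by
  obtain ⟨C, hC⟩ := exists_abs_deriv_cycleDeviation_le hβ b
  -- The maximum with 1 makes the constant positive, since it is divided by later.
  refine ⟨max C 1, by positivity, fun N hN E _ φ => ?_⟩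
  have hd := (hasDerivAt_lineMagnetization β b).add ((HasDerivAt.fun_sum
    (u := (Finset.univ : Finset (Component φ))) fun k _ =>
    (hasDerivAt_cycleDeviation hβ k.size b).differentiableAt.hasDerivAt).div_const (N : ℝ))
  rw [susceptibility, funext (magnetization_halfEdgeGraph hN φ hβ)]
  erw [hd.deriv]
  rw [add_sub_cancel_left, abs_div, Nat.abs_cast, ← mul_div_assoc]
  gcongr
  refine (Finset.abs_sum_le_sum_abs _ _).trans ((Finset.sum_le_card_nsmul _ _ _ fun k _ =>
    (hC k.size).trans (le_max_left C 1)).trans ?_)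
  rw [nsmul_eq_mul, mul_comm, Finset.card_univ]

/-! ### The cycle -/

/-- The half-edges of the cycle, edge `i` joining `i` to its successor. -/
def cycleHalfEdges (N : ℕ) : Fin N × Bool ≃ Fin N × Bool where
  toFun p := bif p.2 then (finRotate N p.1, false) else (p.1, true)
  invFun p := bif p.2 then (p.1, false) else ((finRotate N).symm p.1, true)
  left_inv := by
    rintro ⟨i, _ | _⟩ <;> simp only [cond_true, cond_false, Equiv.symm_apply_apply]
  right_inv := by
    rintro ⟨i, _ | _⟩ <;> simp only [cond_true, cond_false, Equiv.apply_symm_apply]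

theorem cycle_eq_halfEdgeGraph (N : ℕ) : cycle N = halfEdgeGraph (cycleHalfEdges N) := rfl

theorem card_component_cycleHalfEdges_le (N : ℕ) :
    Fintype.card (Component (cycleHalfEdges N)) ≤ 1 := by
  rw [Fintype.card_le_one_iff_subsingleton]
  rcases N with _ | N
  · exact ⟨fun a => by obtain ⟨v, -⟩ := Quot.exists_rep a; exact v.elim0⟩
  have h : ∀ v : Fin (N + 1), (Quot.mk _ v : Component (cycleHalfEdges (N + 1)))
      = Quot.mk _ 0 := by
    intro v
    induction v using Fin.induction with
    | zero => rfl
    | succ i ih =>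
      rw [← ih]
      refine (Quot.sound ⟨i.castSucc, rfl, ?_⟩).symm
      change finRotate (N + 1) i.castSucc = i.succ
      rw [finRotate_apply, Fin.coeSucc_eq_succ]
  refine ⟨fun a b => ?_⟩
  obtain ⟨v, rfl⟩ := Quot.exists_rep a
  obtain ⟨w, rfl⟩ := Quot.exists_rep b
  rw [h v, h w]

theorem tendsto_susceptibility_cycle {β : ℝ} (hβ : 0 ≤ β) (b : ℝ) :
    Tendsto (fun N : ℕ => susceptibility (cycle N) β b) atTop (𝓝 (lineSusceptibility β b)) := by
  obtain ⟨C, hC0, hC⟩ := exists_abs_susceptibility_sub_le hβ b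
  rw [tendsto_iff_norm_sub_tendsto_zero]
  refine squeeze_zero' (Eventually.of_forall fun _ => norm_nonneg _) ?_
    (tendsto_const_div_atTop_nhds_zero_nat C)
  filter_upwards [eventually_ne_atTop 0] with N hN
  rw [cycle_eq_halfEdgeGraph]
  refine (hC N hN _ (cycleHalfEdges N)).trans ?_
  rw [← mul_div_assoc]
  gcongr
  exact mul_le_of_le_one_right hC0.le
    (by exact_mod_cast card_component_cycleHalfEdges_le N)

/-! ### Almost sure convergence of the quenched susceptibility -/

-- With both eigenvalues replaced by 1, the colouring sum counts the 2-colourings of the components;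
-- its mean over pairings is thus already known.
open scoped Classical in
theorem two_pow_card_component {N : ℕ} {E : Type} [Fintype E] (φ : E × Bool ≃ Fin N × Bool) :
    (2 : ℝ) ^ Fintype.card (Component φ)
      = ∑ y : Fin N → Bool, if IsMono φ y then ∏ v, (fun _ => (1 : ℝ)) (y v) else 0 := by
  rw [sum_mono_eq_prod_component φ (fun _ : Bool => (1 : ℝ))]
  norm_num [Finset.prod_const]

/-- Markov's inequality for `2 ^ #components`: a deviation above `ε` forces more than `ε N / C`
components. -/
theorem twoRegularCM_susceptibility_le {β : ℝ} (hβ : 0 ≤ β) (b : ℝ) {ε : ℝ} (hε : 0 < ε) :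
    ∃ ρ : ℝ, 0 < ρ ∧ ρ < 1 ∧ ∀ N : ℕ, N ≠ 0 →
      (twoRegularCM N).real
        {G | ε < |susceptibility G β b - lineSusceptibility β b|} ≤ (N + 1) * ρ ^ N := by
  obtain ⟨C, hC0, hC⟩ := exists_abs_susceptibility_sub_le hβ b
  -- With this `ρ`, the quantity `ρ ^ N * 2 ^ #components` is at least 1 on the bad event.
  refine ⟨(2 : ℝ) ^ (-(ε / C)), by positivity, Real.rpow_lt_one_of_one_lt_of_neg (by norm_num)
    (neg_lt_zero.2 (div_pos hε hC0)), fun N hN => ?_⟩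
  classical
  have hN0 : (0 : ℝ) < N := Nat.cast_pos.2 (Nat.pos_of_ne_zero hN)
  set A : Set (Multigraph (Fin N)) :=
    {G | ε < |susceptibility G β b - lineSusceptibility β b|}
  have hA : (twoRegularCM N).real A = ∫ G, A.indicator 1 G ∂twoRegularCM N :=
    (integral_indicator_one (show MeasurableSet[⊤] A from trivial)).symm
  set ρ := (2 : ℝ) ^ (-(ε / C))
  have hρ : 0 < ρ := by positivity
  have key : ∀ π : Pairing (fun _ : Fin N => 2), A.indicator (1 : Multigraph (Fin N) → ℝ)
      π.toMultigraph ≤ ρ ^ N * ∑ y : Fin N → Bool,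
        (if ∀ h, y (π.1 h).1 = y h.1 then ∏ v, (fun _ => (1 : ℝ)) (y v) else 0) := by
    intro π
    obtain ⟨E, _, φ, h1, h2⟩ := π.exists_eq_halfEdgeGraph
    simp_rw [← h2]
    rw [← two_pow_card_component, h1]
    by_cases hG : halfEdgeGraph φ ∈ A
    · rw [Set.indicator_of_mem hG, Pi.one_apply]
      have h3 : ε < C * (Fintype.card (Component φ) / N) := lt_of_lt_of_le hG (hC N hN E φ)
      have h4 : ε / C * N ≤ Fintype.card (Component φ) := by
        rw [div_mul_eq_mul_div, div_le_iff₀ hC0]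
        rw [← mul_div_assoc, lt_div_iff₀ hN0] at h3
        linarith
      rw [← Real.rpow_natCast, ← Real.rpow_natCast, ← Real.rpow_mul (by norm_num),
        ← Real.rpow_add (by norm_num)]
      exact Real.one_le_rpow (by norm_num) (by linarith)
    · rw [Set.indicator_of_notMem hG]
      positivity
  have hcard : (0 : ℝ) < Fintype.card (Pairing fun _ : Fin N => 2) :=
    Nat.cast_pos.2 Fintype.card_pos
  rw [hA, integral_twoRegularCM, inv_mul_le_iff₀ hcard]
  refine (Finset.sum_le_sum fun π _ => key π).trans ?_
  rw [← Finset.mul_sum, sum_pairing_sum_mono N fun _ => (1 : ℝ)]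
  have h5 := cyclePolynomial_one_le N
  rw [cyclePolynomial] at h5
  simp only [one_pow, one_mul, Algebra.algebraMap_self, RingHom.id_apply] at h5 ⊢
  calc _ ≤ ρ ^ N * (Fintype.card (Pairing fun _ : Fin N => 2) * ((N : ℝ) + 1)) := by gcongr
    _ = _ := by ring

/-- Borel-Cantelli for summable probabilities needs only the marginal laws, hence no assumption on
the coupling. -/
theorem ae_tendsto_susceptibility {Ω : Type*} [MeasurableSpace Ω] (P : Measure Ω)
    (G : (N : ℕ) → Ω → Multigraph (Fin N))
    (hG : ∀ N, 1 ≤ N → HasLaw (G N) (twoRegularCM N) P) {β : ℝ} (hβ : 0 ≤ β) (b : ℝ) :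
    ∀ᵐ ω ∂P, Tendsto (fun N : ℕ => susceptibility (G N ω) β b) atTop
      (𝓝 (lineSusceptibility β b)) := by
  have key : ∀ j : ℕ, ∀ᵐ ω ∂P, ∀ᶠ N in atTop,
      |susceptibility (G N ω) β b - lineSusceptibility β b| ≤ 1 / ((j : ℝ) + 1) := by
    intro j
    have hε : (0 : ℝ) < 1 / ((j : ℝ) + 1) := by positivity
    obtain ⟨ρ, hρ, hρ1, hb⟩ := twoRegularCM_susceptibility_le hβ b hε
    set A : (N : ℕ) → Set (Multigraph (Fin N)) := fun N =>
      {G | 1 / ((j : ℝ) + 1) < |susceptibility G β b - lineSusceptibility β b|}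
    have hs : Summable fun N : ℕ => ((N : ℝ) + 1) * ρ ^ N := by
      have hρ' : ‖ρ‖ < 1 := by rwa [Real.norm_of_nonneg hρ.le]
      refine ((summable_pow_mul_geometric_of_norm_lt_one 1 hρ').add
        (summable_geometric_of_lt_one hρ.le hρ1)).congr fun N => ?_
      ring
    -- The shift by one avoids `N = 0`, where no law is prescribed.
    have hle : ∀ N : ℕ, P (G (N + 1) ⁻¹' A (N + 1))
        ≤ ENNReal.ofReal ((((N + 1 : ℕ) : ℝ) + 1) * ρ ^ (N + 1)) := by
      intro N
      have hlaw := hG (N + 1) (by omega)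
      rw [← Measure.map_apply_of_aemeasurable hlaw.aemeasurable trivial, hlaw.map_eq,
        ← ofReal_measureReal]
      exact ENNReal.ofReal_le_ofReal (hb (N + 1) N.succ_ne_zero)
    have hsum : ∑' N, P (G (N + 1) ⁻¹' A (N + 1)) ≠ ∞ := by
      refine ne_top_of_le_ne_top ?_ (ENNReal.tsum_le_tsum hle)
      exact ((summable_nat_add_iff 1).2 hs).tsum_ofReal_ne_top
    filter_upwards [ae_eventually_notMem hsum] with ω hω
    obtain ⟨n, hn⟩ := eventually_atTop.1 hω
    refine eventually_atTop.2 ⟨n + 1, fun N hN => ?_⟩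
    obtain ⟨M, rfl⟩ : ∃ M, N = M + 1 := ⟨N - 1, by omega⟩
    exact not_lt.1 (hn M (by omega))
  filter_upwards [ae_all_iff.2 key] with ω hω
  rw [Metric.tendsto_nhds]
  intro ε hε
  obtain ⟨j, hj⟩ := exists_nat_one_div_lt hε
  filter_upwards [hω j] with N hN
  rw [Real.dist_eq]
  exact hN.trans_lt hj

/-! ### Expansion of the complex eigenvalue -/

theorem hasDerivAt_complexHalfGap {β : ℝ} {z : ℂ}
    (hz : Complex.exp β ^ 2 * Complex.sinh z ^ 2 + Complex.exp (-β) ^ 2 ∈ Complex.slitPlane) :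
    HasDerivAt (complexHalfGap β)
      (Complex.exp β ^ 2 * Complex.sinh z * Complex.cosh z / complexHalfGap β z) z := by
  have h : HasDerivAt (fun z => Complex.exp β ^ 2 * Complex.sinh z ^ 2 + Complex.exp (-β) ^ 2)
      (Complex.exp β ^ 2 * (((2 : ℕ) : ℂ) * Complex.sinh z ^ (2 - 1) * Complex.cosh z)) z :=
    (((Complex.hasDerivAt_sinh z).pow 2).const_mul _).add_const _
  refine (h.cpow_const hz).congr_deriv ?_
  have h0 := Complex.slitPlane_ne_zero hz
  have h1 : (Complex.exp β ^ 2 * Complex.sinh z ^ 2 + Complex.exp (-β) ^ 2) ^ (1 / 2 - 1 : ℂ)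
      = (complexHalfGap β z)⁻¹ := by
    rw [complexHalfGap, ← Complex.cpow_neg]
    norm_num
  rw [h1]
  push_cast
  ring

theorem complexHalfGap_ne_zero {β : ℝ} {z : ℂ}
    (hz : Complex.exp β ^ 2 * Complex.sinh z ^ 2 + Complex.exp (-β) ^ 2 ∈ Complex.slitPlane) :
    complexHalfGap β z ≠ 0 := fun h => by
  have := complexHalfGap_sq β z
  rw [h] at this
  exact Complex.slitPlane_ne_zero hz (by simpa using this.symm)

/-- At a real field the radicand is positive, so the principal square root is differentiable nearby.
-/
theorem eventually_mem_slitPlane (β b : ℝ) : ∀ᶠ z : ℂ in 𝓝 (b : ℂ),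
    Complex.exp β ^ 2 * Complex.sinh z ^ 2 + Complex.exp (-β) ^ 2 ∈ Complex.slitPlane := by
  have hc : Continuous fun z : ℂ =>
      Complex.exp β ^ 2 * Complex.sinh z ^ 2 + Complex.exp (-β) ^ 2 := by fun_prop
  refine hc.continuousAt.eventually_mem (Complex.isOpen_slitPlane.mem_nhds ?_)
  have : Complex.exp β ^ 2 * Complex.sinh b ^ 2 + Complex.exp (-β) ^ 2
      = ((Real.exp β ^ 2 * Real.sinh b ^ 2 + Real.exp (-β) ^ 2 : ℝ) : ℂ) := by
    push_cast
    rfl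
  rw [this, Complex.ofReal_mem_slitPlane]
  positivity

/-- The magnetization of the one-dimensional model for a complex field. -/
def complexLineMagnetization (β : ℝ) (z : ℂ) : ℂ :=
  Complex.exp β * Complex.sinh z / complexHalfGap β z

theorem complexLineMagnetization_ofReal (β b : ℝ) :
    complexLineMagnetization β b = lineMagnetization β b := by
  rw [complexLineMagnetization, lineMagnetization, complexHalfGap_ofReal]
  push_cast
  rfl

theorem hasDerivAt_complexLineMagnetization (β b : ℝ) :
    HasDerivAt (complexLineMagnetization β) (lineSusceptibility β b) (b : ℂ) := by
  have hz := (eventually_mem_slitPlane β b).self_of_nhds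
  have h0 := complexHalfGap_ne_zero hz
  refine (((Complex.hasDerivAt_sinh (b : ℂ)).const_mul (Complex.exp β)).div
    (hasDerivAt_complexHalfGap hz) h0).congr_deriv ?_
  have h1 := complexHalfGap_sq β b
  rw [lineSusceptibility]
  push_cast
  rw [← complexHalfGap_ofReal]
  field_simp
  rw [h1]
  ring

theorem hasDerivAt_complexEigenvalue_false {β : ℝ} {z : ℂ}
    (hz : Complex.exp β ^ 2 * Complex.sinh z ^ 2 + Complex.exp (-β) ^ 2 ∈ Complex.slitPlane) :
    HasDerivAt (fun z => complexEigenvalue β z false)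
      (complexLineMagnetization β z * complexEigenvalue β z false) z := by
  have h := ((Complex.hasDerivAt_cosh z).const_mul (Complex.exp β)).add
    (hasDerivAt_complexHalfGap hz)
  rw [show (fun z => complexEigenvalue β z false)
    = fun z => Complex.exp β * Complex.cosh z + complexHalfGap β z from
    funext (complexEigenvalue_false β)]
  refine h.congr_deriv ?_
  have := complexHalfGap_ne_zero hz
  rw [complexEigenvalue_false, complexLineMagnetization]
  field_simp
  ring

theorem continuousAt_complexEigenvalue (β b : ℝ) (t : Bool) :
    ContinuousAt (fun z => complexEigenvalue β z t) (b : ℂ) := by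
  have hs := (hasDerivAt_complexHalfGap (eventually_mem_slitPlane β b).self_of_nhds).continuousAt
  have hc : ContinuousAt (fun z => Complex.exp β * Complex.cosh z) (b : ℂ) := by fun_prop
  cases t
  · simp_rw [complexEigenvalue_false]
    exact hc.add hs
  · simp_rw [complexEigenvalue_true]
    exact hc.sub hs

/-! ### Second-order expansion and the limit of powers. -/

/-- The remainder has derivative `f' x - c x`, of size at most `ε |t|` on `[-|t|, |t|]`; the mean
value inequality gains another factor `|t|`. Differentiability of `f'` is needed only at 0. -/
theorem isLittleO_of_hasDerivAt_two {f f' : ℝ → ℂ} {c : ℂ} (h0 : f 0 = 1) (h0' : f' 0 = 0)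
    (hf : ∀ᶠ t in 𝓝 0, HasDerivAt f (f' t) t) (hf' : HasDerivAt f' c 0) :
    (fun t : ℝ => f t - 1 - c * t ^ 2 / 2) =o[𝓝 0] fun t : ℝ => (t : ℂ) ^ 2 := by
  rw [Asymptotics.isLittleO_iff]
  intro ε hε
  have h1 := (hasDerivAt_iff_isLittleO.1 hf').def hε
  obtain ⟨δ, hδ, hball⟩ := Metric.eventually_nhds_iff.1 (h1.and hf)
  refine Metric.eventually_nhds_iff.2 ⟨δ, hδ, fun t ht => ?_⟩
  have hder : ∀ x ∈ Set.Icc (-|t|) |t|, HasDerivWithinAt (fun t : ℝ => f t - 1 - c * t ^ 2 / 2)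
      (f' x - c * x) (Set.Icc (-|t|) |t|) x := by
    intro x hx
    have hx' : dist x 0 < δ := by
      rw [Real.dist_eq, sub_zero] at ht ⊢
      exact (abs_le.2 hx).trans_lt ht
    have h2 : HasDerivAt (fun t : ℝ => c * (t : ℂ) ^ 2 / 2)
        (c * (((2 : ℕ) : ℂ) * (x : ℂ) ^ (2 - 1) * 1) / 2) x :=
      (((hasDerivAt_id x).ofReal_comp.pow 2).const_mul c).div_const 2
    refine ((((hball hx').2).sub_const 1).sub h2).hasDerivWithinAt.congr_deriv ?_
    push_cast
    ring
  have hbound : ∀ x ∈ Set.Icc (-|t|) |t|, ‖f' x - c * x‖ ≤ ε * |t| := by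
    intro x hx
    have hx' : dist x 0 < δ := by
      rw [Real.dist_eq, sub_zero] at ht ⊢
      exact (abs_le.2 hx).trans_lt ht
    have h3 := (hball hx').1
    rw [h0', sub_zero, sub_zero, Real.norm_eq_abs, Complex.real_smul,
      mul_comm (x : ℂ) c] at h3
    exact h3.trans (mul_le_mul_of_nonneg_left (abs_le.2 hx) hε.le)
  have := (convex_Icc (-|t|) |t|).norm_image_sub_le_of_norm_hasDerivWithin_le hder hbound
    (x := 0) (y := t) (by simp) ⟨neg_abs_le t, le_abs_self t⟩
  simp only [h0, sub_zero, Complex.ofReal_zero, Real.norm_eq_abs] at this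
  rw [norm_pow, Complex.norm_real, Real.norm_eq_abs]
  calc _ ≤ ε * |t| * |t| := by simpa using this
    _ = _ := by ring

theorem tendsto_pow_of_hasDerivAt_two {f f' : ℝ → ℂ} {c : ℂ} (h0 : f 0 = 1) (h0' : f' 0 = 0)
    (hf : ∀ᶠ t in 𝓝 0, HasDerivAt f (f' t) t) (hf' : HasDerivAt f' c 0) (s : ℝ) :
    Tendsto (fun N : ℕ => f (s / √(N : ℝ)) ^ N) atTop (𝓝 (Complex.exp (c * s ^ 2 / 2))) := by
  have hu : Tendsto (fun N : ℕ => s / √(N : ℝ)) atTop (𝓝 0) :=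
    (Real.tendsto_sqrt_atTop.comp tendsto_natCast_atTop_atTop).const_div_atTop s
  have h1 := (isLittleO_of_hasDerivAt_two h0 h0' hf hf').tendsto_div_nhds_zero.comp hu
  have h2 : Tendsto (fun N : ℕ => (N : ℂ) * (f (s / √(N : ℝ)) - 1)) atTop
      (𝓝 (c * s ^ 2 / 2)) := by
    have h3 := (h1.const_mul ((s : ℂ) ^ 2)).add_const (c * s ^ 2 / 2)
    rw [mul_zero, zero_add] at h3
    refine h3.congr' ?_
    filter_upwards [eventually_ne_atTop 0] with N hN
    have hN' : (N : ℂ) ≠ 0 := Nat.cast_ne_zero.2 hN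
    have hsq : (((√(N : ℝ) : ℝ) : ℂ)) ^ 2 = N := by
      rw [← Complex.ofReal_pow, Real.sq_sqrt (Nat.cast_nonneg N), Complex.ofReal_natCast]
    have hsq0 : ((√(N : ℝ) : ℝ) : ℂ) ≠ 0 := fun h => hN' (by rw [← hsq, h]; simp)
    simp only [Function.comp]
    -- For `s = 0` the quotient by the squared increment is degenerate.
    rcases eq_or_ne s 0 with rfl | hs
    · simp [h0]
    · have hs' : (s : ℂ) ≠ 0 := Complex.ofReal_ne_zero.2 hs
      push_cast
      rw [div_pow, hsq]
      field_simp
      ring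
  have h4 := Complex.tendsto_one_add_pow_exp_of_tendsto h2
  simpa using h4

/-- The phase removes the first-order term of `λ₊` along the imaginary direction; the second
derivative at 0 is then `i² χ = -χ`. -/
theorem tendsto_complexEigenvalue_pow (β b s : ℝ) :
    Tendsto (fun N : ℕ => (complexEigenvalue β (b + (s / √(N : ℝ) : ℝ) * Complex.I) false /
        eigenvalue β b false *
        Complex.exp (-(lineMagnetization β b * (s / √(N : ℝ) : ℝ) * Complex.I))) ^ N) atTop
      (𝓝 (Complex.exp (-lineSusceptibility β b * s ^ 2 / 2))) := by
  have hlam : (eigenvalue β b false : ℂ) ≠ 0 :=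
    Complex.ofReal_ne_zero.2 (eigenvalue_false_pos β b).ne'
  have hpath : ∀ t : ℝ, HasDerivAt (fun t : ℝ => (b : ℂ) + (t : ℂ) * Complex.I) Complex.I t :=
    fun t => by
      simpa using ((hasDerivAt_id t).ofReal_comp.mul_const Complex.I).const_add (b : ℂ)
  have hp0 : (b : ℂ) + ((0 : ℝ) : ℂ) * Complex.I = b := by simp
  let f : ℝ → ℂ := fun t => complexEigenvalue β (b + t * Complex.I) false /
    eigenvalue β b false * Complex.exp (-(lineMagnetization β b * t * Complex.I))
  have hf0 : f 0 = 1 := by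
    simp only [f]
    rw [hp0, complexEigenvalue_ofReal, div_self hlam]
    simp
  let f' : ℝ → ℂ := fun t => (complexLineMagnetization β (b + t * Complex.I) -
    lineMagnetization β b) * Complex.I * f t
  have hf : ∀ᶠ t in 𝓝 (0 : ℝ), HasDerivAt f (f' t) t := by
    have hc : Tendsto (fun t : ℝ => (b : ℂ) + (t : ℂ) * Complex.I) (𝓝 0) (𝓝 (b : ℂ)) := by
      have := (hpath 0).continuousAt.tendsto
      rwa [hp0] at this
    filter_upwards [hc.eventually (eventually_mem_slitPlane β b)] with t ht
    have h1 := ((hasDerivAt_complexEigenvalue_false ht).comp t (hpath t)).div_const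
      (eigenvalue β b false : ℂ)
    have h2 : HasDerivAt (fun t : ℝ => Complex.exp (-(lineMagnetization β b * t * Complex.I)))
        (Complex.exp (-(lineMagnetization β b * t * Complex.I)) *
          -(lineMagnetization β b * 1 * Complex.I)) t :=
      ((((hasDerivAt_id t).ofReal_comp.const_mul _).mul_const Complex.I).neg).cexp
    refine (h1.mul h2).congr_deriv ?_
    simp only [f', f, Function.comp]
    ring
  have hf' : HasDerivAt f' (-lineSusceptibility β b) 0 := by
    have hm := hasDerivAt_complexLineMagnetization β b
    rw [← hp0] at hm
    have h1 := ((hm.comp (0 : ℝ) (hpath 0)).sub_const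
      (lineMagnetization β b : ℂ)).mul_const Complex.I
    refine (h1.mul hf.self_of_nhds).congr_deriv ?_
    simp only [f', Function.comp, hf0, hp0, complexLineMagnetization_ofReal, sub_self, zero_mul,
      mul_zero, add_zero, mul_one]
    rw [mul_assoc, Complex.I_mul_I]
    ring
  refine tendsto_pow_of_hasDerivAt_two hf0 ?_ hf hf' s
  simp only [f']
  rw [hp0, complexLineMagnetization_ofReal, sub_self, zero_mul, zero_mul]

/-! ### The annealed measure -/

instance : MeasurableSingletonClass ℤˣ :=
  ⟨fun u => ⟨{(u : ℤ)}, measurableSet_singleton _, by ext v; simp [Units.ext_iff]⟩⟩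

theorem annealedProb_twoRegularCM {N : ℕ} (β b : ℝ) (σ : SpinConfig N) :
    annealedProb (twoRegularCM N) β b σ
      = (∑ π : Pairing (fun _ : Fin N => 2), boltzmannWeight π.toMultigraph β b σ) /
        ∑ π : Pairing (fun _ : Fin N => 2), partitionFunction π.toMultigraph β b := by
  rw [annealedProb, integral_twoRegularCM, integral_twoRegularCM, mul_div_mul_left]
  exact inv_ne_zero (Nat.cast_ne_zero.2 Fintype.card_ne_zero)

theorem annealedProb_twoRegularCM_nonneg {N : ℕ} (β b : ℝ) (σ : SpinConfig N) :
    0 ≤ annealedProb (twoRegularCM N) β b σ := by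
  rw [annealedProb_twoRegularCM]
  exact div_nonneg (Finset.sum_nonneg fun _ _ => (boltzmannWeight_pos _ _ _ _).le)
    (Finset.sum_nonneg fun _ _ => (partitionFunction_pos _ _ _).le)

theorem integral_annealedMeasure {N : ℕ} {F : Type*} [NormedAddCommGroup F] [NormedSpace ℝ F]
    [CompleteSpace F] (β b : ℝ) (f : SpinConfig N → F) :
    ∫ σ, f σ ∂annealedMeasure (twoRegularCM N) β b
      = ∑ σ, annealedProb (twoRegularCM N) β b σ • f σ := by
  rw [annealedMeasure, integral_finsetSum_measure fun _ _ =>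
    Integrable.of_finite.smul_measure ENNReal.ofReal_ne_top]
  refine Finset.sum_congr rfl fun σ _ => ?_
  rw [integral_smul_measure, integral_dirac,
    ENNReal.toReal_ofReal (annealedProb_twoRegularCM_nonneg β b σ)]

theorem sum_partitionFunction (N : ℕ) (β b : ℝ) :
    ∑ π : Pairing (fun _ : Fin N => 2), partitionFunction π.toMultigraph β b
      = Fintype.card (Pairing fun _ : Fin N => 2) * (eigenvalue β b false ^ N *
        cyclePolynomial N (eigenRatio β b)) := by
  have h := sum_complexPartition N β (z := b) (by
    rw [complexHalfGap_ofReal]; exact Complex.ofReal_ne_zero.2 (halfGap_pos β b).ne') (by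
    rw [complexEigenvalue_ofReal]; exact Complex.ofReal_ne_zero.2 (eigenvalue_false_pos β b).ne')
  rw [complexEigenvalue_ofReal, complexEigenvalue_ofReal, ← Complex.ofReal_div,
    cyclePolynomial_ofReal] at h
  apply Complex.ofReal_injective
  push_cast
  refine Eq.trans (Finset.sum_congr rfl fun π _ => ?_) h
  rw [partitionFunction, complexPartition]
  push_cast
  exact Finset.sum_congr rfl fun σ _ => ofReal_boltzmannWeight _ _ _ _

/-- The annealed mean of the total spin differs from that of the infinite line by `O(1)`. -/
theorem exists_abs_integral_totalSpin_sub_le {β : ℝ} (hβ : 0 ≤ β) (b : ℝ) :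
    ∃ C, ∀ N : ℕ, |∫ σ, totalSpin σ ∂annealedMeasure (twoRegularCM N) β b
      - N * lineMagnetization β b| ≤ C := by
  have hr0 := eigenRatio_nonneg hβ b
  obtain ⟨C, hC⟩ := exists_abs_deriv_cyclePolynomial_le hr0 (eigenRatio_lt_one β b)
  refine ⟨C * |-2 * lineMagnetization β b * eigenRatio β b|, fun N => ?_⟩
  have hcard : (Fintype.card (Pairing fun _ : Fin N => 2) : ℝ) ≠ 0 :=
    Nat.cast_ne_zero.2 Fintype.card_ne_zero
  have hlam := (eigenvalue_false_pos β b).ne'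
  have hA := one_le_cyclePolynomial N hr0
  have hA0 : cyclePolynomial N (eigenRatio β b) ≠ 0 := by positivity
  -- Differentiating the averaged partition function in the field brings down the total spin.
  have h1 : ∫ σ, totalSpin σ ∂annealedMeasure (twoRegularCM N) β b
      = logDeriv (fun b => ∑ π : Pairing (fun _ : Fin N => 2),
        partitionFunction π.toMultigraph β b) b := by
    have hd : HasDerivAt (fun b => ∑ π : Pairing (fun _ : Fin N => 2),
        partitionFunction π.toMultigraph β b) _ b :=
      HasDerivAt.fun_sum fun π _ => hasDerivAt_partitionFunction π.toMultigraph β b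
    rw [integral_annealedMeasure, logDeriv_apply, hd.deriv, Finset.sum_comm, Finset.sum_div]
    refine Finset.sum_congr rfl fun σ _ => ?_
    rw [annealedProb_twoRegularCM, smul_eq_mul, ← Finset.sum_mul]
    ring
  have hd2 := (((hasDerivAt_eigenvalue_false β b).pow N).mul
    ((hasDerivAt_cyclePolynomial N (eigenRatio β b)).comp b (hasDerivAt_eigenRatio β b))).const_mul
      (Fintype.card (Pairing fun _ : Fin N => 2) : ℝ)
  rw [h1, funext (sum_partitionFunction N β), logDeriv_apply]
  erw [hd2.deriv]
  set D := ∑ k ∈ Finset.range (N + 1), k * eigenRatio β b ^ (k - 1) * splitCoeff N k with hD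
  -- The power of the eigenvalue contributes exactly `N * m`; what remains is the logarithmic
  -- derivative of the cycle polynomial, bounded since the polynomial is at least 1.
  have h2 : (Fintype.card (Pairing fun _ : Fin N => 2) : ℝ) *
      (N * eigenvalue β b false ^ (N - 1) * (lineMagnetization β b * eigenvalue β b false) *
        cyclePolynomial N (eigenRatio β b) + eigenvalue β b false ^ N *
          (D * (-2 * lineMagnetization β b * eigenRatio β b))) /
      (Fintype.card (Pairing fun _ : Fin N => 2) *
        (eigenvalue β b false ^ N * cyclePolynomial N (eigenRatio β b)))
      - N * lineMagnetization β b
      = D * (-2 * lineMagnetization β b * eigenRatio β b) /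
        cyclePolynomial N (eigenRatio β b) := by
    have h3 : (N : ℝ) * eigenvalue β b false ^ (N - 1) *
        (lineMagnetization β b * eigenvalue β b false)
        = N * lineMagnetization β b * eigenvalue β b false ^ N := by
      rcases N with _ | N
      · simp
      · rw [Nat.add_sub_cancel]
        ring
    rw [h3]
    field_simp
    ring
  refine (congrArg abs h2).trans_le ?_
  rw [abs_div, abs_mul, abs_of_pos (by linarith : 0 < cyclePolynomial N (eigenRatio β b))]
  exact (div_le_self (by positivity) hA).trans (by gcongr; exact hC N)

/-- Multiplying the weight by `exp (i u S)`, `u = s / √N`, shifts the field to `b + i u`, so a ratio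
of averaged partition functions appears. The centring phase is split into `N` equal phases, absorbed
in the power, and a correction for `M - N * m`. -/
theorem charFun_annealedMeasure {N : ℕ} (β b M s : ℝ)
    (hz : complexHalfGap β (b + (s / √(N : ℝ) : ℝ) * Complex.I) ≠ 0)
    (h0 : complexEigenvalue β (b + (s / √(N : ℝ) : ℝ) * Complex.I) false ≠ 0) :
    charFun ((annealedMeasure (twoRegularCM N) β b).map
        fun σ : SpinConfig N => (totalSpin σ - M) / √(N : ℝ)) s
      = (complexEigenvalue β (b + (s / √(N : ℝ) : ℝ) * Complex.I) false /
        eigenvalue β b false *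
        Complex.exp (-(lineMagnetization β b * (s / √(N : ℝ) : ℝ) * Complex.I))) ^ N *
        Complex.exp (-((s / √(N : ℝ) * (M - N * lineMagnetization β b) : ℝ) * Complex.I)) *
        (cyclePolynomial N (complexEigenvalue β (b + (s / √(N : ℝ) : ℝ) * Complex.I) true /
          complexEigenvalue β (b + (s / √(N : ℝ) : ℝ) * Complex.I) false) /
          cyclePolynomial N (eigenRatio β b : ℂ)) := by
  set u : ℝ := s / √(N : ℝ) with hu
  set z : ℂ := b + u * Complex.I with hz_def
  have hcard : (Fintype.card (Pairing fun _ : Fin N => 2) : ℂ) ≠ 0 :=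
    Nat.cast_ne_zero.2 Fintype.card_ne_zero
  have hlam : (eigenvalue β b false : ℂ) ≠ 0 :=
    Complex.ofReal_ne_zero.2 (eigenvalue_false_pos β b).ne'
  rw [charFun_apply_real, integral_map (by fun_prop) (by fun_prop), integral_annealedMeasure]
  have h1 : ∀ σ : SpinConfig N, annealedProb (twoRegularCM N) β b σ •
      Complex.exp (s * ((totalSpin σ - M) / √(N : ℝ) : ℝ) * Complex.I)
      = (∑ π : Pairing (fun _ : Fin N => 2), complexWeight π.toMultigraph β z σ) *
        (Complex.exp (-(u * M * Complex.I)) /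
          (∑ π : Pairing (fun _ : Fin N => 2), partitionFunction π.toMultigraph β b : ℝ)) := by
    intro σ
    have e : ((∑ π : Pairing (fun _ : Fin N => 2), boltzmannWeight π.toMultigraph β b σ : ℝ) : ℂ) *
        Complex.exp (s * ((totalSpin σ - M) / √(N : ℝ) : ℝ) * Complex.I)
        = (∑ π : Pairing (fun _ : Fin N => 2), complexWeight π.toMultigraph β z σ) *
          Complex.exp (-(u * M * Complex.I)) := by
      push_cast
      rw [Finset.sum_mul, Finset.sum_mul]
      refine Finset.sum_congr rfl fun π _ => ?_
      rw [ofReal_boltzmannWeight, complexWeight, complexWeight, ← Complex.exp_add,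
        ← Complex.exp_add]
      congr 1
      rw [hz_def, hu]
      push_cast
      ring
    rw [annealedProb_twoRegularCM, Complex.real_smul, Complex.ofReal_div, div_mul_eq_mul_div, e,
      mul_div_assoc]
  rw [Finset.sum_congr rfl fun σ _ => h1 σ, ← Finset.sum_mul, Finset.sum_comm]
  have h2 := sum_complexPartition N β hz h0
  simp only [complexPartition] at h2
  rw [h2, sum_partitionFunction]
  push_cast
  rw [← cyclePolynomial_ofReal, mul_pow, ← Complex.exp_nat_mul, div_pow]
  have h3 : Complex.exp (N * -(lineMagnetization β b * u * Complex.I)) *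
      Complex.exp (-(u * (M - N * lineMagnetization β b) * Complex.I))
      = Complex.exp (-(u * M * Complex.I)) := by
    rw [← Complex.exp_add]
    congr 1
    ring
  rw [← h3, mul_div_mul_comm]
  field_simp

theorem tendstoInDistribution_totalSpin {β : ℝ} (hβ : 0 ≤ β) (b : ℝ) {χ : ℝ≥0}
    (hχ : (χ : ℝ) = lineSusceptibility β b) :
    TendstoInDistribution
      (fun (N : ℕ) (σ : SpinConfig N) =>
        (totalSpin σ - ∫ τ, totalSpin τ ∂(annealedMeasure (twoRegularCM N) β b)) / √(N : ℝ))
      atTop (id : ℝ → ℝ)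
      (fun N => annealedMeasure (twoRegularCM N) β b) (gaussianReal 0 χ) := by
  refine ⟨fun N => by fun_prop, by fun_prop, ?_⟩
  refine ProbabilityMeasure.tendsto_iff_tendsto_charFun.2 fun s => ?_
  simp only [ProbabilityMeasure.coe_mk, Measure.map_id]
  rw [charFun_gaussianReal, hχ]
  have hu : Tendsto (fun N : ℕ => s / √(N : ℝ)) atTop (𝓝 0) :=
    (Real.tendsto_sqrt_atTop.comp tendsto_natCast_atTop_atTop).const_div_atTop s
  have hz : Tendsto (fun N : ℕ => (b : ℂ) + (s / √(N : ℝ) : ℝ) * Complex.I) atTop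
      (𝓝 (b : ℂ)) := by
    have := (((Complex.continuous_ofReal.tendsto 0).comp hu).mul_const Complex.I).const_add (b : ℂ)
    simpa using this
  have hlam : (eigenvalue β b false : ℂ) ≠ 0 :=
    Complex.ofReal_ne_zero.2 (eigenvalue_false_pos β b).ne'
  have hl : ∀ t, Tendsto (fun N : ℕ =>
      complexEigenvalue β (b + (s / √(N : ℝ) : ℝ) * Complex.I) t) atTop
      (𝓝 (eigenvalue β b t : ℂ)) := by
    intro t
    rw [← complexEigenvalue_ofReal]
    exact (continuousAt_complexEigenvalue β b t).tendsto.comp hz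
  have hr : Tendsto (fun N : ℕ => complexEigenvalue β (b + (s / √(N : ℝ) : ℝ) * Complex.I) true /
      complexEigenvalue β (b + (s / √(N : ℝ) : ℝ) * Complex.I) false) atTop
      (𝓝 (eigenRatio β b : ℂ)) := by
    rw [eigenRatio, Complex.ofReal_div]
    exact (hl true).div (hl false) hlam
  have hr0 := eigenRatio_nonneg hβ b
  have hr1 : ‖(eigenRatio β b : ℂ)‖ < 1 := by
    rw [Complex.norm_real, Real.norm_of_nonneg hr0]
    exact eigenRatio_lt_one β b
  have hp1 := tendsto_cyclePolynomial hr hr1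
  have hp2 := tendsto_cyclePolynomial (tendsto_const_nhds (x := (eigenRatio β b : ℂ))) hr1
  -- At the real ratio every cycle polynomial is at least 1, so the common limit cannot vanish.
  have hlim : (∑' k, (eigenRatio β b : ℂ) ^ k * (returnProb k : ℂ)) ≠ 0 := by
    have h1 : (1 : ℝ) ≤ ‖∑' k, (eigenRatio β b : ℂ) ^ k * (returnProb k : ℂ)‖ := by
      refine ge_of_tendsto' hp2.norm fun N => ?_
      rw [cyclePolynomial_ofReal, Complex.norm_real]
      exact (one_le_cyclePolynomial N hr0).trans (le_abs_self _)
    rw [← norm_pos_iff]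
    linarith
  have hmean : Tendsto (fun N : ℕ => Complex.exp (-((s / √(N : ℝ) *
      (∫ τ, totalSpin τ ∂(annealedMeasure (twoRegularCM N) β b) -
        N * lineMagnetization β b) : ℝ) * Complex.I))) atTop (𝓝 1) := by
    obtain ⟨C, hC⟩ := exists_abs_integral_totalSpin_sub_le hβ b
    have h1 : Tendsto (fun N : ℕ => s / √(N : ℝ) *
        (∫ τ, totalSpin τ ∂(annealedMeasure (twoRegularCM N) β b) -
        N * lineMagnetization β b)) atTop (𝓝 0) :=
      -- A factor of order `1 / √N` times a bounded error in the mean.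
      hu.zero_mul_isBoundedUnder_le ⟨C, eventually_map.2 (Eventually.of_forall hC)⟩
    have h2 := ((((Complex.continuous_ofReal.tendsto 0).comp h1).mul_const Complex.I).neg).cexp
    simpa using h2
  have h := ((tendsto_complexEigenvalue_pow β b s).mul hmean).mul (hp1.div hp2 hlim)
  rw [div_self hlim, mul_one, mul_one] at h
  have hlimit : Complex.exp (s * (0 : ℝ) * Complex.I - lineSusceptibility β b * s ^ 2 / 2)
      = Complex.exp (-lineSusceptibility β b * s ^ 2 / 2) := by
    congr 1
    simp
    ring
  rw [hlimit]
  refine h.congr' ?_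
  filter_upwards [(hl false).eventually_ne hlam,
    hz.eventually (eventually_mem_slitPlane β b)] with N h0 hs
  exact (charFun_annealedMeasure β b _ s (complexHalfGap_ne_zero hs) h0).symm

end

theorem mainTheorem4 {Ω : Type*} [MeasurableSpace Ω] (P : Measure Ω) [IsProbabilityMeasure P]
    (G : (N : ℕ) → Ω → Multigraph (Fin N))
    (hG : ∀ N, 1 ≤ N → HasLaw (G N) (twoRegularCM N) P)
    (β B : ℝ) (hβ : 0 ≤ β) :
    ∃ χ : ℝ≥0,
      TendstoInDistribution
        (fun (N : ℕ) (σ : SpinConfig N) =>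
          (totalSpin σ - ∫ τ, totalSpin τ ∂(annealedMeasure (twoRegularCM N) β B)) / √(N : ℝ))
        atTop (id : ℝ → ℝ)
        (fun N => annealedMeasure (twoRegularCM N) β B) (gaussianReal 0 χ) ∧
      (∀ᵐ ω ∂P, Tendsto (fun N : ℕ => susceptibility (G N ω) β B) atTop (𝓝 (χ : ℝ))) ∧
      Tendsto (fun N : ℕ => susceptibility (cycle N) β B) atTop (𝓝 (χ : ℝ)) ∧
      (χ : ℝ) = Real.cosh B * Real.exp (-4 * β) /
        (Real.sinh B ^ 2 + Real.exp (-4 * β)) ^ (3 / 2 : ℝ) :=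
  ⟨⟨lineSusceptibility β B, (lineSusceptibility_pos β B).le⟩,
    tendstoInDistribution_totalSpin hβ B rfl, ae_tendsto_susceptibility P G hG hβ B,
    tendsto_susceptibility_cycle hβ B, lineSusceptibility_eq β B⟩
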